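/- Let $n,k\ge 0$ be integers, let $V\subset\mathbb{R}^n$ be an $n$-dimensional (closed) simplex, i.e. the convex hull of $n+1$ affinely independent points, and let $f_1,\dots,f_k:\mathbb{R}^n\to\mathbb{R}$ be polynomials of degree at most $1$ with real coefficients, none of which vanishes at any point of the interior of $V$. Let $E_s(\boldsymbol{x})$ be a complex-valued function that is (complex) analytic in $(s,\boldsymbol{x})$ on a neighbourhood of $\mathbb{C}\times V$ in $\mathbb{C}^{n+1}=\mathbb{C}\times\mathbb{C}^n$. For $\Re(s)>0$ put $$I(s)=\int_V \bigl(f_1(\boldsymbol{x})\cdots f_k(\boldsymbol{x})\bigr)^{s}\,E_s(\boldsymbol{x})\,dx_1\cdots dx_n ,$$ where $a^s=\exp(s\operatorname{Log} a)$ with the principal logarithm for real $a\neq 0$ (so $\operatorname{Log}a=\log|a|+\pi i$ for $a<0$) and $0^s=0$, and where an empty product is $1$. Then this integral converges absolutely and is analytic in $s$ for $\Re(s)>0$, and: 1. $I(s)$ extends to a meromorphic function on $\mathbb{C}$; 2. all poles of this extension are at rational numbers $s\in\mathbb{Q}$; 3. every pole has order at most $n$; 4. every pole also has order at most $k$, the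 number of linear polynomials. -/

import Mathlib

open MeasureTheory

open MeasureTheory

/-! The singularities of (f_1⋯f_k)^s are resolved explicitly, until the integrand is a monomial in
coordinates of the unit cube times an analytic function. The continuation then comes from
integration by parts.

Model case: take the integral over [0,1]^n of ∏ u_j^(c_j s + b_j) E_s(u). By parts in u_g, c_g s +
b_g + 1 times this integral is a boundary term free of u_g minus an integral with b_g raised by one.
After c_g M steps u_g no longer obstructs convergence on Re s > -M. The cost is a division by ∏ (c_g
s + b_g + l + 1), whose roots are rational and distinct. So each variable with c_j ≠ 0 adds at most
one to the order of a pole (`hasMeroExt_powIntegral`).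

Reduction to the cube: the simplex is cut into n+1 pieces according to which barycentric coordinate
is largest, each the image of the cube under a projective chart (`setIntegral_convexHull_eq_sum`).
There f_m becomes (1 + Σ y)⁻¹ times an affine form whose coefficients are the values of f_m at the
vertices. These values do not have opposite signs (`AffineMap.exists_sign_of_ne_zero_on_interior`),
so up to an entire factor all coefficients may be taken nonnegative. A form with nonzero constant
term is positive on the cube and its power joins E; the others are homogeneous.

Resolution: blow up the subspace on which all variables of the homogeneous forms vanish
(`hasMeroExt_formProd`). In the chart of y_j, y_j factors out of every form, and at least one form
becomes a positive unit. Each blow-up thus adds at most one monomial variable and removes at least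
one form, so at most min(n, k) variables carry c_j ≠ 0. This yields both bounds on the order.

Finally the continuations to Re s > -M, for all M, agree and are glued
(`exists_meromorphic_of_hasMeroExt`). -/

/-! ### Continuation to half-planes with bounded pole order -/

/-- `I`, given on `0 < re s`, has a meromorphic continuation to `-M < re s` whose poles are
rational numbers with `re s ≤ 0`, each of order at most `d`. -/
def HasMeroExt (M d : ℕ) (I : ℂ → ℂ) : Prop :=
  ∃ F : ℂ → ℂ, (∀ s : ℂ, 0 < s.re → F s = I s) ∧
    ∀ s : ℂ, -(M : ℝ) < s.re → MeromorphicAt F s ∧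
      ((-(d : ℤ) : ℤ) : WithTop ℤ) ≤ meromorphicOrderAt F s ∧
      ((0 < s.re ∨ ∀ q : ℚ, s ≠ q) → AnalyticAt ℂ F s)

namespace HasMeroExt

variable {M d : ℕ} {I J : ℂ → ℂ}

theorem congr (h : HasMeroExt M d I) (hIJ : ∀ s : ℂ, 0 < s.re → I s = J s) :
    HasMeroExt M d J := by
  obtain ⟨F, h1, h2⟩ := h
  exact ⟨F, fun s hs => (h1 s hs).trans (hIJ s hs), h2⟩

theorem mono {d' : ℕ} (h : HasMeroExt M d I) (hd : d ≤ d') : HasMeroExt M d' I := by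
  obtain ⟨F, h1, h2⟩ := h
  refine ⟨F, h1, fun s hs => ⟨(h2 s hs).1, le_trans ?_ (h2 s hs).2.1, (h2 s hs).2.2⟩⟩
  exact_mod_cast (by omega : (-(d' : ℤ)) ≤ -(d : ℤ))

theorem of_analyticAt (h : ∀ s : ℂ, -(M : ℝ) < s.re → AnalyticAt ℂ I s) : HasMeroExt M d I := by
  refine ⟨I, fun _ _ => rfl, fun s hs =>
    ⟨(h s hs).meromorphicAt, le_trans ?_ (h s hs).meromorphicOrderAt_nonneg, fun _ => h s hs⟩⟩
  exact_mod_cast (by omega : (-(d : ℤ)) ≤ 0)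

theorem add (hI : HasMeroExt M d I) (hJ : HasMeroExt M d J) :
    HasMeroExt M d (fun s => I s + J s) := by
  obtain ⟨F, h1, h2⟩ := hI
  obtain ⟨G, k1, k2⟩ := hJ
  refine ⟨F + G, fun s hs => by simp [h1 s hs, k1 s hs], fun s hs => ?_⟩
  obtain ⟨a1, a2, a3⟩ := h2 s hs
  obtain ⟨b1, b2, b3⟩ := k2 s hs
  exact ⟨a1.add b1, le_trans (le_min a2 b2) (meromorphicOrderAt_add a1 b1),
    fun h => (a3 h).add (b3 h)⟩

theorem sum {ι : Type*} (T : Finset ι) {K : ι → ℂ → ℂ} (h : ∀ i ∈ T, HasMeroExt M d (K i)) :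
    HasMeroExt M d (fun s => ∑ i ∈ T, K i s) := by
  classical
  induction T using Finset.induction_on with
  | empty =>
    simpa using of_analyticAt (M := M) (d := d) (I := fun _ => 0) (fun s _ => analyticAt_const)
  | insert i T hi ih =>
    refine ((h i (by simp)).add (ih fun j hj => h j (by simp [hj]))).congr fun s _ => ?_
    simp [Finset.sum_insert hi]

theorem analytic_mul {g : ℂ → ℂ} (hI : HasMeroExt M d I) (hg : ∀ s, AnalyticAt ℂ g s) :
    HasMeroExt M d (fun s => g s * I s) := by
  obtain ⟨F, h1, h2⟩ := hI
  refine ⟨g * F, fun s hs => by simp [h1 s hs], fun s hs => ?_⟩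
  obtain ⟨a1, a2, a3⟩ := h2 s hs
  refine ⟨(hg s).meromorphicAt.mul a1, ?_, fun h => (hg s).mul (a3 h)⟩
  rw [meromorphicOrderAt_mul (hg s).meromorphicAt a1]
  calc _ ≤ meromorphicOrderAt F s := a2
    _ = 0 + meromorphicOrderAt F s := (zero_add _).symm
    _ ≤ _ := add_le_add_left (hg s).meromorphicOrderAt_nonneg _

end HasMeroExt

/-- The factors have distinct roots -(b + l + 1)/c, so at most one of them vanishes at a given
point, and it does so simply. -/
theorem meromorphicOrderAt_prod_linear_le_one {c : ℕ} (hc : 1 ≤ c) (b N : ℕ) (s : ℂ) :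
    meromorphicOrderAt (fun z : ℂ => ∏ l ∈ Finset.range N, ((c : ℂ) * z + (b + l + 1 : ℕ))) s
      ≤ 1 := by
  have hc' : (c : ℂ) ≠ 0 := by exact_mod_cast (by omega : c ≠ 0)
  by_cases hs : ∃ l ∈ Finset.range N, (c : ℂ) * s + (b + l + 1 : ℕ) = 0
  · obtain ⟨l, hl, h0⟩ := hs
    -- Since the `l`-th factor vanishes at `s`, it equals c(z - s).
    have key : (fun z : ℂ => ∏ l ∈ Finset.range N, ((c : ℂ) * z + (b + l + 1 : ℕ)))
        = (fun z => z - s) *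
          (fun z => c * ∏ m ∈ (Finset.range N).erase l, ((c : ℂ) * z + (b + m + 1 : ℕ))) := by
      funext z
      rw [← Finset.mul_prod_erase _ _ hl]
      simp only [Pi.mul_apply]
      linear_combination (h0) * ∏ m ∈ (Finset.range N).erase l, ((c : ℂ) * z + (b + m + 1 : ℕ))
    have han : AnalyticAt ℂ (fun z : ℂ => (c : ℂ) * ∏ m ∈ (Finset.range N).erase l,
        ((c : ℂ) * z + (b + m + 1 : ℕ))) s := by fun_prop
    rw [key, meromorphicOrderAt_mul (by fun_prop) han.meromorphicAt]
    have e1 : meromorphicOrderAt (fun z : ℂ => z - s) s = (1 : ℤ) :=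
      (meromorphicOrderAt_eq_int_iff (by fun_prop)).2
        ⟨fun _ => 1, analyticAt_const, one_ne_zero, by simp⟩
    have e2 : meromorphicOrderAt (fun z : ℂ => (c : ℂ) * ∏ m ∈ (Finset.range N).erase l,
        ((c : ℂ) * z + (b + m + 1 : ℕ))) s = 0 := by
      rw [han.meromorphicOrderAt_eq, han.analyticOrderAt_eq_zero.2]
      · rfl
      · refine mul_ne_zero hc' (Finset.prod_ne_zero_iff.2 fun m hm h => ?_)
        have h2 := h.trans h0.symm
        have h3 : b + m + 1 = b + l + 1 := by exact_mod_cast add_left_cancel h2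
        exact (Finset.mem_erase.1 hm).1 (by omega)
    rw [e1, e2]; simp
  · push Not at hs
    have han : AnalyticAt ℂ (fun z : ℂ => ∏ l ∈ Finset.range N,
        ((c : ℂ) * z + (b + l + 1 : ℕ))) s := by fun_prop
    rw [han.meromorphicOrderAt_eq, han.analyticOrderAt_eq_zero.2]
    · simp
    · exact Finset.prod_ne_zero_iff.2 hs

/-- Dividing by the product costs one pole order however many factors it has, and only at the
negative rationals -(b + l + 1)/c. -/
theorem HasMeroExt.of_prod_mul {M d : ℕ} {I G : ℂ → ℂ} {c : ℕ} (hc : 1 ≤ c) (b N : ℕ)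
    (hG : HasMeroExt M d G)
    (h : ∀ s : ℂ, 0 < s.re →
      (∏ l ∈ Finset.range N, ((c : ℂ) * s + (b + l + 1 : ℕ))) * I s = G s) :
    HasMeroExt M (d + 1) I := by
  obtain ⟨F, h1, h2⟩ := hG
  set P : ℂ → ℂ := fun z => ∏ l ∈ Finset.range N, ((c : ℂ) * z + (b + l + 1 : ℕ)) with hP
  have hPan : ∀ s, AnalyticAt ℂ P s := fun s => by fun_prop
  have hc' : (c : ℂ) ≠ 0 := by exact_mod_cast (by omega : c ≠ 0)
  have hP0 : ∀ s : ℂ, (0 < s.re ∨ ∀ q : ℚ, s ≠ q) → P s ≠ 0 := by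
    intro s hs
    refine Finset.prod_ne_zero_iff.2 fun l _ h0 => ?_
    rcases hs with hs | hs
    · have := congrArg Complex.re h0
      simp only [Complex.add_re, Complex.mul_re, Complex.natCast_re, Complex.natCast_im, zero_mul,
        sub_zero, Complex.zero_re] at this
      have : 0 ≤ (c : ℝ) * s.re := by positivity
      have h4 : (0 : ℝ) < (b + l + 1 : ℕ) := by exact_mod_cast Nat.succ_pos _
      linarith
    · refine hs (-((b + l + 1 : ℕ) : ℚ) / c) ?_
      push_cast at h0 ⊢
      rw [eq_div_iff hc']
      linear_combination h0
  refine ⟨P⁻¹ * F, fun s hs => ?_, fun s hs => ?_⟩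
  · have := hP0 s (Or.inl hs)
    simp only [Pi.mul_apply, Pi.inv_apply, h1 s hs, ← h s hs]
    exact inv_mul_cancel_left₀ this _
  · obtain ⟨a1, a2, a3⟩ := h2 s hs
    refine ⟨(hPan s).meromorphicAt.inv.mul a1, ?_, fun h => ((hPan s).inv (hP0 s h)).mul (a3 h)⟩
    rw [meromorphicOrderAt_mul (hPan s).meromorphicAt.inv a1, meromorphicOrderAt_inv]
    have hle := meromorphicOrderAt_prod_linear_le_one hc b N s
    change meromorphicOrderAt P s ≤ 1 at hle
    have hne : meromorphicOrderAt P s ≠ ⊤ := fun h => by simp [h] at hle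
    obtain ⟨m, hm⟩ := WithTop.ne_top_iff_exists.1 hne
    rw [← hm] at hle ⊢
    have hm1 : m ≤ 1 := by exact_mod_cast hle
    calc ((-((d + 1 : ℕ) : ℤ) : ℤ) : WithTop ℤ) = ((-1 : ℤ) : WithTop ℤ) + ((-(d : ℤ) : ℤ)) := by
          rw [← WithTop.coe_add]; congr 1; push_cast; ring
      _ ≤ ((-m : ℤ) : WithTop ℤ) + meromorphicOrderAt F s :=
          add_le_add (by exact_mod_cast (by omega : -1 ≤ -m)) a2
      _ = _ := rfl

/-! ### Gluing the continuations over all half-planes -/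

/-- Two continuations coincide near 1, so by the identity theorem their difference has infinite
order at every point of the common half-plane. The glued function takes its value at z from a
half-plane chosen by ‖z‖. -/
theorem exists_meromorphic_of_hasMeroExt {d : ℕ} {I : ℂ → ℂ} (h : ∀ M, HasMeroExt M d I) :
    ∃ F : ℂ → ℂ, Meromorphic F ∧ (∀ s : ℂ, 0 < s.re → F s = I s ∧ AnalyticAt ℂ F s) ∧
      (∀ s : ℂ, ¬ AnalyticAt ℂ F s → ∃ q : ℚ, s = (q : ℂ)) ∧
      (∀ s : ℂ, ((-(d : ℤ) : ℤ) : WithTop ℤ) ≤ meromorphicOrderAt F s) := by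
  choose G h1 h2 using h
  have hagree : ∀ m m' : ℕ, ∀ s : ℂ, -(m : ℝ) < s.re → -(m' : ℝ) < s.re →
      G m =ᶠ[nhdsWithin s {s}ᶜ] G m' := by
    intro m m' s hs hs'
    set U : Set ℂ := {z | max (-(m : ℝ)) (-(m' : ℝ)) < z.re} with hU
    have hUc : IsConnected U := by
      refine ⟨⟨s, max_lt hs hs'⟩, (convex_halfSpace_re_gt _).isPreconnected⟩
    have hmer : MeromorphicOn (G m - G m') U := fun z hz =>
      (h2 m z (lt_of_le_of_lt (le_max_left _ _) hz)).1.sub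
        (h2 m' z (lt_of_le_of_lt (le_max_right _ _) hz)).1
    have h1U : (1 : ℂ) ∈ U := by
      simp only [hU, Set.mem_ofPred_eq, Complex.one_re]
      exact max_lt (by have : (0:ℝ) ≤ m := by positivity
                       linarith) (by have : (0:ℝ) ≤ m' := by positivity
                                     linarith)
    have htop : meromorphicOrderAt (G m - G m') s = ⊤ := by
      by_contra hne
      have := (hmer.exists_meromorphicOrderAt_ne_top_iff_forall hUc).1
        ⟨⟨s, max_lt hs hs'⟩, hne⟩ ⟨1, h1U⟩
      refine this (meromorphicOrderAt_eq_top_iff.2 (Filter.Eventually.filter_mono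
        nhdsWithin_le_nhds ?_))
      have : {z : ℂ | 0 < z.re} ∈ nhds (1 : ℂ) :=
        (isOpen_lt continuous_const Complex.continuous_re).mem_nhds (by simp)
      filter_upwards [this] with z hz
      simp [h1 m z hz, h1 m' z hz]
    filter_upwards [meromorphicOrderAt_eq_top_iff.1 htop] with z hz
    exact sub_eq_zero.1 hz
  -- The margin 2 keeps `s` in the half-plane of index `N z` whenever ‖z - s‖ < 1. Only finitely
  -- many indices occur for such z, so finitely many punctured-neighbourhood agreements suffice. At
  -- z = s the values agree by definition.
  let N : ℂ → ℕ := fun s => ⌊‖s‖⌋₊ + 2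
  have hN : ∀ s z : ℂ, ‖z - s‖ < 1 → -(N z : ℝ) < s.re ∧ N z < ⌊‖s‖⌋₊ + 5 := by
    intro s z hz
    have t1 : ‖s‖ ≤ ‖z‖ + 1 := by
      have := norm_sub_norm_le s z
      rw [norm_sub_rev] at this; linarith
    have t2 : ‖z‖ ≤ ‖s‖ + 1 := by
      have := norm_sub_norm_le z s
      linarith
    constructor
    · have h3 := Nat.lt_floor_add_one ‖z‖
      have h4 := (abs_le.1 (Complex.abs_re_le_norm s)).1
      simp only [N]; push_cast; linarith
    · have : ⌊‖z‖⌋₊ ≤ ⌊‖s‖⌋₊ + 1 := by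
        rw [← Nat.floor_add_one (norm_nonneg s)]
        exact Nat.floor_le_floor t2
      simp only [N]; omega
  have hNs : ∀ s, -(N s : ℝ) < s.re := fun s => (hN s s (by simp)).1
  have hF : ∀ s, (fun z => G (N z) z) =ᶠ[nhds s] G (N s) := by
    intro s
    have hev : ∀ᶠ z in nhdsWithin s {s}ᶜ, ∀ m ∈ Finset.range (⌊‖s‖⌋₊ + 5),
        -(m : ℝ) < s.re → G m z = G (N s) z := by
      rw [Filter.eventually_all_finset]
      intro m _
      by_cases hm : -(m : ℝ) < s.re
      · filter_upwards [hagree m (N s) s hm (hNs s)] with z hz _ using hz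
      · exact Filter.Eventually.of_forall fun z h => absurd h hm
    have hev2 := eventually_nhdsWithin_iff.1 hev
    filter_upwards [hev2, Metric.ball_mem_nhds s one_pos] with z hz hball
    by_cases hzs : z = s
    · rw [hzs]
    · have := hN s z (by rwa [Metric.mem_ball, dist_eq_norm] at hball)
      exact hz hzs (N z) (Finset.mem_range.2 this.2) this.1
  refine ⟨fun z => G (N z) z, fun s => ?_, fun s hs => ⟨h1 _ s hs, ?_⟩, fun s hs => ?_,
    fun s => ?_⟩
  · exact (h2 (N s) s (hNs s)).1.congr ((hF s).symm.filter_mono nhdsWithin_le_nhds)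
  · exact ((h2 (N s) s (hNs s)).2.2 (Or.inl hs)).congr (hF s).symm
  · by_contra hq
    push Not at hq
    exact hs (((h2 (N s) s (hNs s)).2.2 (Or.inr hq)).congr (hF s).symm)
  · rw [meromorphicOrderAt_congr ((hF s).filter_mono nhdsWithin_le_nhds)]
    exact (h2 (N s) s (hNs s)).2.1

/-! ### Holomorphy of integrals depending on a parameter -/

/-- Cauchy's estimate turns the bound on the functions into a bound on their derivatives, so
dominated differentiation applies. -/
theorem differentiableAt_integral_of_bounded {α : Type*} [MeasurableSpace α] {μ : Measure α}
    [IsFiniteMeasure μ] {G : ℂ → α → ℂ} {s₀ : ℂ} {r C : ℝ} (hr : 0 < r)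
    (hmeas : ∀ s ∈ Metric.ball s₀ r, AEStronglyMeasurable (G s) μ)
    (hdiff : ∀ᵐ a ∂μ, DifferentiableOn ℂ (fun s => G s a) (Metric.ball s₀ r))
    (hbound : ∀ᵐ a ∂μ, ∀ s ∈ Metric.ball s₀ r, ‖G s a‖ ≤ C) :
    DifferentiableAt ℂ (fun s => ∫ a, G s a ∂μ) s₀ := by
  have hball : Metric.ball s₀ r ∈ nhds s₀ := Metric.ball_mem_nhds _ hr
  have hs₀ : s₀ ∈ Metric.ball s₀ r := Metric.mem_ball_self hr
  -- The derivative is an almost everywhere limit of measurable difference quotients along a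
  -- sequence of increments.
  have hderiv : AEStronglyMeasurable (fun a => deriv (fun s => G s a) s₀) μ := by
    let v : ℕ → ℂ := fun m => ((r / 2 / (m + 1) : ℝ) : ℂ)
    have hv0 : ∀ m, v m ≠ 0 := fun m => by
      have : (0 : ℝ) < r / 2 / (m + 1) := by positivity
      simp only [v]; exact_mod_cast this.ne'
    have hvr : ∀ m, s₀ + v m ∈ Metric.ball s₀ r := fun m => by
      have : r / 2 / ((m : ℝ) + 1) ≤ r / 2 :=
        div_le_self (by positivity) (by linarith [(Nat.cast_nonneg m : (0 : ℝ) ≤ m)])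
      simp only [v, Metric.mem_ball, dist_self_add_left, Complex.norm_real, Real.norm_eq_abs]
      rw [abs_of_pos (by positivity)]
      linarith
    have hvt : Filter.Tendsto v Filter.atTop (nhds 0) := by
      have h1 : Filter.Tendsto (fun m : ℕ => r / 2 * (1 / ((m : ℝ) + 1))) Filter.atTop
          (nhds (r / 2 * 0)) := tendsto_one_div_add_atTop_nhds_zero_nat.const_mul _
      have h2 := (Complex.continuous_ofReal.tendsto _).comp h1
      simp only [mul_zero, Complex.ofReal_zero] at h2
      refine h2.congr fun m => ?_
      simp [v, div_eq_mul_inv]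
    refine aestronglyMeasurable_of_tendsto_ae Filter.atTop
      (f := fun m a => (v m)⁻¹ • (G (s₀ + v m) a - G s₀ a))
      (fun m => AEStronglyMeasurable.const_smul ((hmeas _ (hvr m)).sub (hmeas _ hs₀)) (v m)⁻¹) ?_
    filter_upwards [hdiff] with a ha
    have hd := (ha.differentiableAt hball).hasDerivAt.tendsto_slope_zero
    exact hd.comp (tendsto_nhdsWithin_iff.2 ⟨hvt, Filter.Eventually.of_forall hv0⟩)
  -- Circles of radius r/4 centred in the ball of radius r/2 stay inside the ball of radius r.
  refine (hasDerivAt_integral_of_dominated_loc_of_deriv_le (F' := fun s a =>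
    deriv (fun s => G s a) s) (bound := fun _ => C / (r / 4))
    (Metric.ball_mem_nhds s₀ (by positivity : 0 < r / 2)) ?_ ?_ hderiv ?_
    (integrable_const _) ?_).2.differentiableAt
  · filter_upwards [hball] with s hs using hmeas s hs
  · exact Integrable.of_bound (hmeas _ hs₀) C (hbound.mono fun a ha => ha s₀ hs₀)
  · filter_upwards [hdiff, hbound] with a ha hb s hs
    have hsub : Metric.closedBall s (r / 4) ⊆ Metric.ball s₀ r := fun z hz => by
      simp only [Metric.mem_closedBall, Metric.mem_ball] at *
      linarith [dist_triangle z s s₀]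
    refine Complex.norm_deriv_le_of_forall_mem_sphere_norm_le (by positivity) ?_
      fun z hz => hb z (hsub (Metric.sphere_subset_closedBall hz))
    exact DifferentiableOn.diffContOnCl (ha.mono (Metric.closure_ball_subset_closedBall.trans hsub))
  · filter_upwards [hdiff] with a ha s hs
    exact (ha.differentiableAt (Metric.isOpen_ball.mem_nhds
      (Metric.ball_subset_ball (by linarith) hs))).hasDerivAt

/-! ### The unit cube: Fubini in one coordinate, analytic functions near it -/

/-- The unit cube `[0,1]ⁿ`. -/
def cube (n : ℕ) : Set (Fin n → ℝ) := Set.Icc 0 1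

/-- The inclusion `ℝⁿ → ℂⁿ`. -/
def cx {n : ℕ} (x : Fin n → ℝ) : Fin n → ℂ := fun j => (x j : ℂ)

/-- `E` is analytic in a neighbourhood of `ℂ × [0,1]ⁿ` in `ℂ × ℂⁿ`. -/
def AnalyticOnCube {n : ℕ} (E : ℂ × (Fin n → ℂ) → ℂ) : Prop :=
  AnalyticOnNhd ℂ E {p | ∃ x ∈ cube n, p.2 = cx x}

section Cube

variable {n : ℕ}

theorem mem_cube {x : Fin n → ℝ} : x ∈ cube n ↔ ∀ j, 0 ≤ x j ∧ x j ≤ 1 := by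
  simp [cube, Set.mem_Icc, Pi.le_def, forall_and]

theorem isCompact_cube : IsCompact (cube n) := isCompact_Icc

theorem measurableSet_cube : MeasurableSet (cube n) := measurableSet_Icc

theorem continuous_cx : Continuous (cx : (Fin n → ℝ) → Fin n → ℂ) := by
  unfold cx; fun_prop

theorem volume_restrict_cube : (volume : Measure (Fin n → ℝ)).restrict (cube n)
    = Measure.pi fun _ => (volume : Measure ℝ).restrict (Set.Icc 0 1) := by
  rw [← Measure.restrict_pi_pi, volume_pi, cube, ← Set.pi_univ_Icc]
  rfl

instance : IsProbabilityMeasure ((volume : Measure ℝ).restrict (Set.Icc 0 1)) :=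
  ⟨by simp⟩

instance : IsProbabilityMeasure ((volume : Measure (Fin n → ℝ)).restrict (cube n)) := by
  rw [volume_restrict_cube]; infer_instance

theorem ae_cube_ne_zero :
    ∀ᵐ u ∂(volume : Measure (Fin n → ℝ)).restrict (cube n), ∀ j, u j ≠ 0 := by
  refine ae_restrict_of_ae (ae_all_iff.2 fun j => ?_)
  rw [volume_pi]
  exact Measure.ae_eval_ne (μ := fun _ : Fin n => (volume : Measure ℝ)) j 0

theorem update_mem_cube {u : Fin n → ℝ} (hu : u ∈ cube n) (g : Fin n) {t : ℝ}
    (ht : t ∈ Set.Icc (0 : ℝ) 1) : Function.update u g t ∈ cube n := by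
  rw [mem_cube] at *
  intro j
  by_cases h : j = g
  · subst h; simpa using ht
  · simpa [h] using hu j

/-- Resampling one coordinate uniformly preserves the product probability measure. This gives Fubini
in the g-th variable without splitting off a factor of the product space. -/
theorem measurePreserving_update (g : Fin n) :
    MeasurePreserving (fun p : (Fin n → ℝ) × ℝ => Function.update p.1 g p.2)
      (((volume : Measure (Fin n → ℝ)).restrict (cube n)).prod
        ((volume : Measure ℝ).restrict (Set.Icc 0 1)))
      ((volume : Measure (Fin n → ℝ)).restrict (cube n)) := by
  have hmeas : Measurable (fun p : (Fin n → ℝ) × ℝ => Function.update p.1 g p.2) := by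
    refine measurable_pi_iff.2 fun j => ?_
    by_cases h : j = g
    · subst h; simpa using measurable_snd
    · simp only [Function.update_of_ne h]
      exact (measurable_pi_apply j).comp measurable_fst
  refine ⟨hmeas, ?_⟩
  rw [volume_restrict_cube]
  symm
  refine Measure.pi_eq fun s hs => ?_
  rw [Measure.map_apply hmeas (MeasurableSet.univ_pi hs)]
  -- The preimage of a box frees its `g`-th side, which has total mass one, and moves that side to
  -- the second factor.
  have : (fun p : (Fin n → ℝ) × ℝ => Function.update p.1 g p.2) ⁻¹' Set.pi Set.univ s
      = (Set.pi Set.univ (Function.update s g Set.univ)) ×ˢ s g := by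
    ext p
    simp only [Set.mem_preimage, Set.mem_pi, Set.mem_univ, true_implies, Set.mem_prod]
    constructor
    · intro h
      refine ⟨fun j => ?_, by simpa using h g⟩
      by_cases hj : j = g
      · subst hj; simp
      · simpa [hj] using h j
    · rintro ⟨h, hg⟩ j
      by_cases hj : j = g
      · subst hj; simpa using hg
      · simpa [hj] using h j
  rw [this, Measure.prod_prod, Measure.pi_pi, ← Finset.prod_erase_mul _ _ (Finset.mem_univ g),
    ← Finset.prod_erase_mul (Finset.univ) (fun i => (volume.restrict (Set.Icc 0 1)) (s i))
      (Finset.mem_univ g)]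
  congr 1
  rw [Function.update_self, measure_univ, mul_one]
  exact Finset.prod_congr rfl fun j hj => by rw [Function.update_of_ne (Finset.ne_of_mem_erase hj)]

theorem integral_cube_update (g : Fin n) {H : (Fin n → ℝ) → ℂ} (hH : IntegrableOn H (cube n)) :
    IntegrableOn (fun u => ∫ t in (0 : ℝ)..1, H (Function.update u g t)) (cube n) ∧
    ∫ u in cube n, H u = ∫ u in cube n, ∫ t in (0 : ℝ)..1, H (Function.update u g t) := by
  have hmp := measurePreserving_update (n := n) g
  have hi := hmp.integrable_comp_of_integrable hH
  simp_rw [intervalIntegral.integral_of_le (zero_le_one (α := ℝ)), ← integral_Icc_eq_integral_Ioc]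
  refine ⟨hi.integral_prod_left, ?_⟩
  have hmap := integral_map (f := H) hmp.aemeasurable
    (by rw [hmp.map_eq]; exact hH.aestronglyMeasurable)
  rw [hmp.map_eq] at hmap
  rw [hmap]
  exact integral_prod _ hi

namespace AnalyticOnCube

variable {E : ℂ × (Fin n → ℂ) → ℂ}

theorem analyticAt (hE : AnalyticOnCube E) (s : ℂ) {x : Fin n → ℝ} (hx : x ∈ cube n) :
    AnalyticAt ℂ E (s, cx x) := hE (s, cx x) ⟨x, hx, rfl⟩

theorem of_analyticAt (h : ∀ s, ∀ x ∈ cube n, AnalyticAt ℂ E (s, cx x)) : AnalyticOnCube E := by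
  rintro ⟨s, y⟩ ⟨x, hx, rfl⟩
  exact h s x hx

theorem mul {E' : ℂ × (Fin n → ℂ) → ℂ} (hE : AnalyticOnCube E) (hE' : AnalyticOnCube E') :
    AnalyticOnCube (fun p => E p * E' p) := AnalyticOnNhd.mul hE hE'

theorem continuousOn (hE : AnalyticOnCube E) (s : ℂ) :
    ContinuousOn (fun u => E (s, cx u)) (cube n) := fun _ hu =>
  ((hE.analyticAt s hu).continuousAt.comp (f := fun u => (s, cx u))
    (by have := continuous_cx (n := n); fun_prop)).continuousWithinAt

theorem bounded (hE : AnalyticOnCube E) (s₀ : ℂ) :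
    ∃ C, 0 ≤ C ∧ ∀ s ∈ Metric.closedBall s₀ 1, ∀ u ∈ cube n, ‖E (s, cx u)‖ ≤ C := by
  have hc : ContinuousOn (fun p : ℂ × (Fin n → ℝ) => E (p.1, cx p.2))
      (Metric.closedBall s₀ 1 ×ˢ cube n) := fun p hp =>
    ((hE.analyticAt p.1 hp.2).continuousAt.comp (f := fun p : ℂ × (Fin n → ℝ) => (p.1, cx p.2))
      (by have := continuous_cx (n := n); fun_prop)).continuousWithinAt
  obtain ⟨C, hC⟩ := ((isCompact_closedBall s₀ 1).prod isCompact_cube).exists_bound_of_continuousOn hc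
  exact ⟨max C 0, le_max_right _ _, fun s hs u hu => (hC (s, u) ⟨hs, hu⟩).trans (le_max_left _ _)⟩

theorem fderiv_apply (hE : AnalyticOnCube E) (v : ℂ × (Fin n → ℂ)) :
    AnalyticOnCube (fun p => fderiv ℂ E p v) := fun p hp =>
  ((ContinuousLinearMap.apply ℂ ℂ v).analyticAt _).comp (AnalyticOnNhd.fderiv hE p hp)

theorem comp_update (hE : AnalyticOnCube E) (g : Fin n) :
    AnalyticOnCube (fun p => E (p.1, Function.update p.2 g 1)) := by
  refine of_analyticAt fun s x hx => ?_
  have hx' : Function.update x g 1 ∈ cube n := update_mem_cube hx g (by simp)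
  have e : Function.update (cx x) g 1 = cx (Function.update x g 1) := by
    funext j; by_cases h : j = g
    · subst h; simp [cx]
    · simp [h, cx]
  refine AnalyticAt.fun_comp (f := fun p : ℂ × (Fin n → ℂ) => (p.1, Function.update p.2 g 1)) ?_ ?_
  · rw [e]; exact hE.analyticAt s hx'
  · refine analyticAt_fst.prod (analyticAt_pi_iff.2 fun j => ?_)
    by_cases h : j = g
    · subst h; simpa using analyticAt_const
    · simp only [Function.update_of_ne h]
      exact ((ContinuousLinearMap.proj (R := ℂ) (φ := fun _ : Fin n => ℂ) j).analyticAt _).comp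
        analyticAt_snd

end AnalyticOnCube

end Cube

/-! ### Monomial integrals and integration by parts -/

/-- The function `u ↦ ∏ⱼ uⱼ ^ (cⱼ s + bⱼ)` on `ℝⁿ`. -/
noncomputable def powMonomial {n : ℕ} (c b : Fin n → ℕ) (s : ℂ) (u : Fin n → ℝ) : ℂ :=
  ∏ j, (u j : ℂ) ^ ((c j : ℂ) * s + b j)

/-- The integral over the cube of `∏ⱼ uⱼ ^ (cⱼ s + bⱼ) * E (s, u)`. -/
noncomputable def powIntegral {n : ℕ} (c b : Fin n → ℕ) (E : ℂ × (Fin n → ℂ) → ℂ) (s : ℂ) : ℂ :=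
  ∫ u in cube n, powMonomial c b s u * E (s, cx u)

section

variable {n : ℕ} (c b : Fin n → ℕ) {E : ℂ × (Fin n → ℂ) → ℂ}

theorem norm_ofReal_cpow_le_one {x : ℝ} (h0 : 0 ≤ x) (h1 : x ≤ 1) {z : ℂ} (hz : 0 ≤ z.re) :
    ‖(x : ℂ) ^ z‖ ≤ 1 := by
  rcases h0.eq_or_lt with rfl | h
  · by_cases hz0 : z = 0
    · simp [hz0]
    · simp [Complex.zero_cpow hz0]
  · rw [Complex.norm_cpow_eq_rpow_re_of_pos h]
    exact Real.rpow_le_one h0 h1 hz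

theorem norm_powMonomial_le_one {s : ℂ} (hs : ∀ j, 0 ≤ ((c j : ℂ) * s + b j).re)
    {u : Fin n → ℝ} (hu : u ∈ cube n) : ‖powMonomial c b s u‖ ≤ 1 := by
  rw [powMonomial, norm_prod]
  exact Finset.prod_le_one (fun _ _ => norm_nonneg _) fun j _ =>
    norm_ofReal_cpow_le_one (mem_cube.1 hu j).1 (mem_cube.1 hu j).2 (hs j)

theorem measurable_powMonomial (s : ℂ) : Measurable (powMonomial c b s) := by
  unfold powMonomial
  fun_prop

theorem aestronglyMeasurable_powMonomial_mul (hE : AnalyticOnCube E) (s : ℂ) :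
    AEStronglyMeasurable (fun u => powMonomial c b s u * E (s, cx u))
      ((volume : Measure (Fin n → ℝ)).restrict (cube n)) :=
  (measurable_powMonomial c b s).aestronglyMeasurable.mul
    ((hE.continuousOn s).aestronglyMeasurable measurableSet_cube)

theorem integrableOn_powMonomial_mul (hE : AnalyticOnCube E) {s : ℂ}
    (hs : ∀ j, 0 ≤ ((c j : ℂ) * s + b j).re) :
    IntegrableOn (fun u => powMonomial c b s u * E (s, cx u)) (cube n) := by
  obtain ⟨C, hC0, hC⟩ := hE.bounded s
  refine Integrable.of_bound (aestronglyMeasurable_powMonomial_mul c b hE s) C ?_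
  filter_upwards [ae_restrict_mem measurableSet_cube] with u hu
  rw [norm_mul]
  calc _ ≤ 1 * C := mul_le_mul (norm_powMonomial_le_one c b hs hu)
        (hC s (Metric.mem_closedBall_self zero_le_one) u hu) (norm_nonneg _) zero_le_one
    _ = C := one_mul C

/-- For Re s > -M all exponents have nonnegative real part, so the integrand is bounded, locally
uniformly in s, and the integral is holomorphic there. -/
theorem hasMeroExt_powIntegral_of_le (hE : AnalyticOnCube E) {M : ℕ}
    (hb : ∀ j, c j * M ≤ b j) : HasMeroExt M 0 (powIntegral c b E) := by
  have hre : ∀ s : ℂ, -(M : ℝ) < s.re → ∀ j, 0 ≤ ((c j : ℂ) * s + b j).re := by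
    intro s hs j
    have h1 : (c j : ℝ) * M ≤ b j := by exact_mod_cast hb j
    have h2 : (c j : ℝ) * -(M : ℝ) ≤ c j * s.re :=
      mul_le_mul_of_nonneg_left hs.le (Nat.cast_nonneg _)
    simp only [Complex.add_re, Complex.mul_re, Complex.natCast_re, Complex.natCast_im, zero_mul,
      sub_zero]
    linarith
  have hopen : IsOpen {s : ℂ | -(M : ℝ) < s.re} := isOpen_lt continuous_const Complex.continuous_re
  have hdiff : DifferentiableOn ℂ (powIntegral c b E) {s : ℂ | -(M : ℝ) < s.re} := by
    intro s₀ hs₀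
    obtain ⟨C, hC0, hC⟩ := hE.bounded s₀
    obtain ⟨r, hr, hball⟩ := Metric.isOpen_iff.1 hopen s₀ hs₀
    have hr' : 0 < min r 1 := lt_min hr one_pos
    have hball' : Metric.ball s₀ (min r 1) ⊆ {s : ℂ | -(M : ℝ) < s.re} :=
      (Metric.ball_subset_ball (min_le_left _ _)).trans hball
    refine (differentiableAt_integral_of_bounded (C := C) hr'
      (fun s _ => aestronglyMeasurable_powMonomial_mul c b hE s) ?_ ?_).differentiableWithinAt
    · filter_upwards [ae_restrict_mem measurableSet_cube, ae_cube_ne_zero] with u hu h0 s hs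
      refine DifferentiableAt.differentiableWithinAt ?_
      have h1 : DifferentiableAt ℂ (fun s => E (s, cx u)) s :=
        (hE.analyticAt s hu).differentiableAt.comp s (f := fun s => (s, cx u)) (by fun_prop)
      refine DifferentiableAt.mul ?_ h1
      unfold powMonomial
      refine DifferentiableAt.fun_finsetProd fun j _ => ?_
      exact DifferentiableAt.const_cpow (by fun_prop)
        (Or.inl (by exact_mod_cast h0 j))
    · filter_upwards [ae_restrict_mem measurableSet_cube] with u hu s hs
      rw [norm_mul]
      calc _ ≤ 1 * C := mul_le_mul (norm_powMonomial_le_one c b (hre s (hball' hs)) hu)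
            (hC s (Metric.ball_subset_closedBall
              (Metric.ball_subset_ball (min_le_right _ _) hs)) u hu) (norm_nonneg _) zero_le_one
        _ = C := one_mul C
  exact HasMeroExt.of_analyticAt fun s hs => hdiff.analyticAt (hopen.mem_nhds hs)

/-- Integration by parts with antiderivative t^(z+1)/(z+1); its boundary term at 0 vanishes. -/
theorem mul_integral_cpow_mul {e e' : ℝ → ℂ} {z : ℂ} (hz : 0 < z.re)
    (he : ∀ t ∈ Set.Icc (0 : ℝ) 1, HasDerivAt e (e' t) t) (he' : ContinuousOn e' (Set.Icc 0 1)) :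
    (z + 1) * ∫ t in (0 : ℝ)..1, (t : ℂ) ^ z * e t
      = e 1 - ∫ t in (0 : ℝ)..1, (t : ℂ) ^ (z + 1) * e' t := by
  have hz1 : z + 1 ≠ 0 := fun h => by
    have := congrArg Complex.re h
    simp at this; linarith
  have hI : Set.uIcc (0 : ℝ) 1 = Set.Icc 0 1 := Set.uIcc_of_le zero_le_one
  have hcont : Continuous fun t : ℝ => (t : ℂ) ^ (z + 1) / (z + 1) :=
    (Complex.continuous_ofReal_cpow_const (by simp; linarith)).div_const _
  have h := intervalIntegral.integral_mul_deriv_eq_deriv_mul_of_hasDerivAt (a := 0) (b := 1)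
    (u := e) (u' := e') (v := fun t : ℝ => (t : ℂ) ^ (z + 1) / (z + 1)) (v' := fun t => (t : ℂ) ^ z)
    (fun t ht => (he t (hI ▸ ht)).continuousAt.continuousWithinAt) hcont.continuousOn
    (fun t ht => he t (by simp at ht; exact ⟨ht.1.le, ht.2.le⟩))
    (fun t ht => hasDerivAt_ofReal_cpow_const' (r := z) (by simp at ht; exact ht.1.ne')
      (fun h => hz1 (by rw [h]; ring)))
    (ContinuousOn.intervalIntegrable (by rwa [hI]))
    ((Complex.continuous_ofReal_cpow_const hz).intervalIntegrable _ _)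
  have e1 : ∫ t in (0 : ℝ)..1, (t : ℂ) ^ z * e t = ∫ t in (0 : ℝ)..1, e t * (t : ℂ) ^ z :=
    intervalIntegral.integral_congr fun t _ => mul_comm _ _
  have e2 : ∫ t in (0 : ℝ)..1, e' t * ((t : ℂ) ^ (z + 1) / (z + 1))
      = (∫ t in (0 : ℝ)..1, (t : ℂ) ^ (z + 1) * e' t) / (z + 1) := by
    rw [← intervalIntegral.integral_div]
    exact intervalIntegral.integral_congr fun t _ => by ring
  rw [e1, h, e2]
  simp only [Complex.ofReal_one, Complex.one_cpow, Complex.ofReal_zero, Complex.zero_cpow hz1]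
  field_simp
  ring

theorem cx_update (u : Fin n → ℝ) (g : Fin n) (t : ℝ) :
    cx (Function.update u g t) = Function.update (cx u) g (t : ℂ) := by
  funext j
  by_cases h : j = g
  · subst h; simp [cx]
  · simp [h, cx]

theorem AnalyticOnCube.hasDerivAt_update (hE : AnalyticOnCube E) (s : ℂ) {u : Fin n → ℝ}
    (hu : u ∈ cube n) (g : Fin n) {t : ℝ} (ht : t ∈ Set.Icc (0 : ℝ) 1) :
    HasDerivAt (fun t : ℝ => E (s, cx (Function.update u g t)))
      (fderiv ℂ E (s, cx (Function.update u g t)) (0, Pi.single g 1)) t := by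
  have h1 := ((hE.analyticAt s (update_mem_cube hu g ht)).differentiableAt.hasFDerivAt).restrictScalars ℝ
  have h2 : HasDerivAt (fun t : ℝ => (s, cx (Function.update u g t)))
      ((0, Pi.single g 1) : ℂ × (Fin n → ℂ)) t := by
    refine (hasDerivAt_const t s).prodMk (hasDerivAt_pi.2 fun j => ?_)
    by_cases h : j = g
    · subst h
      simpa [cx] using (hasDerivAt_id t).ofReal_comp
    · simpa [cx, h] using hasDerivAt_const t ((u j : ℂ))
  exact h1.comp_hasDerivAt t h2

theorem powMonomial_update (s : ℂ) (u : Fin n → ℝ) (g : Fin n) (t : ℝ) :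
    powMonomial c b s (Function.update u g t)
      = (t : ℂ) ^ ((c g : ℂ) * s + b g)
        * powMonomial (Function.update c g 0) (Function.update b g 0) s u := by
  unfold powMonomial
  rw [← Finset.mul_prod_erase _ _ (Finset.mem_univ g),
    ← Finset.mul_prod_erase _ (fun j => (u j : ℂ) ^ _) (Finset.mem_univ g)]
  simp only [Function.update_self, Nat.cast_zero, zero_mul, add_zero, Complex.cpow_zero, one_mul]
  congr 1
  refine Finset.prod_congr rfl fun j hj => ?_
  simp [Finset.ne_of_mem_erase hj]

/-- The boundary term at u_g = 1 no longer depends on u_g. It stays an integral over the whole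
n-cube with exponent 0 in that variable, so the dimension never changes. -/
theorem mul_powIntegral (hE : AnalyticOnCube E) {s : ℂ} (hs : 0 < s.re) {g : Fin n}
    (hg : 1 ≤ c g) :
    ((c g : ℂ) * s + b g + 1) * powIntegral c b E s
      = powIntegral (Function.update c g 0) (Function.update b g 0)
          (fun p => E (p.1, Function.update p.2 g 1)) s
        - powIntegral c (Function.update b g (b g + 1))
          (fun p => fderiv ℂ E p (0, Pi.single g 1)) s := by
  have hre : ∀ c' b' : Fin n → ℕ, ∀ j, 0 ≤ ((c' j : ℂ) * s + b' j).re := by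
    intro c' b' j
    simp only [Complex.add_re, Complex.mul_re, Complex.natCast_re, Complex.natCast_im, zero_mul,
      sub_zero]
    positivity
  have hz : 0 < ((c g : ℂ) * s + b g).re := by
    have : (0 : ℝ) < c g := by exact_mod_cast hg
    simp only [Complex.add_re, Complex.mul_re, Complex.natCast_re, Complex.natCast_im, zero_mul,
      sub_zero]
    positivity
  have hE' := hE.fderiv_apply (0, Pi.single g 1)
  obtain ⟨i1, e1⟩ := integral_cube_update g (integrableOn_powMonomial_mul c b hE (hre c b))
  obtain ⟨i2, e2⟩ := integral_cube_update g (integrableOn_powMonomial_mul c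
    (Function.update b g (b g + 1)) hE' (hre _ _))
  have i3 := integrableOn_powMonomial_mul (Function.update c g 0) (Function.update b g 0)
    (hE.comp_update g) (hre _ _)
  unfold powIntegral
  rw [e1, e2, ← integral_const_mul, ← integral_sub i3 i2]
  refine setIntegral_congr_fun measurableSet_cube fun u hu => ?_
  have hu1 : Function.update (cx u) g 1 = cx (Function.update u g 1) := by simp [cx_update]
  simp only [powMonomial_update, Function.update_self, Function.update_idem]
  have hparts := mul_integral_cpow_mul hz
    (fun t ht => hE.hasDerivAt_update s hu g ht)
    ((hE'.continuousOn s).comp (f := fun t : ℝ => Function.update u g t) (by fun_prop)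
      fun t ht => update_mem_cube hu g ht)
  set m := powMonomial (Function.update c g 0) (Function.update b g 0) s u with hm
  have a1 : ∀ (z : ℂ) (e : ℝ → ℂ), ∫ t in (0 : ℝ)..1, (t : ℂ) ^ z * m * e t
      = m * ∫ t in (0 : ℝ)..1, (t : ℂ) ^ z * e t := fun z e => by
    rw [← intervalIntegral.integral_const_mul]
    exact intervalIntegral.integral_congr fun t _ => by ring
  have hcast : (c g : ℂ) * s + ((b g + 1 : ℕ) : ℂ) = (c g : ℂ) * s + b g + 1 := by
    push_cast; ring
  rw [hcast, a1 _ (fun t => E (s, cx (Function.update u g t))),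
    a1 _ (fun t => fderiv ℂ E (s, cx (Function.update u g t)) (0, Pi.single g 1)), hu1]
  linear_combination m * hparts

/-- N integrations by parts in one variable. The boundary terms have lost the variable `g`, so `ih`
covers them, and they are collected in `G`. -/
theorem prod_mul_powIntegral {M d : ℕ} (hE : AnalyticOnCube E) {g : Fin n} (hg : 1 ≤ c g)
    (ih : ∀ E' : ℂ × (Fin n → ℂ) → ℂ, AnalyticOnCube E' →
      HasMeroExt M d (powIntegral (Function.update c g 0) (Function.update b g 0) E')) (N : ℕ) :
    ∃ (G : ℂ → ℂ) (E' : ℂ × (Fin n → ℂ) → ℂ), HasMeroExt M d G ∧ AnalyticOnCube E' ∧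
      ∀ s : ℂ, 0 < s.re →
        (∏ l ∈ Finset.range N, ((c g : ℂ) * s + (b g + l + 1 : ℕ))) * powIntegral c b E s
          = G s + powIntegral c (Function.update b g (b g + N)) E' s := by
  induction N with
  | zero =>
    refine ⟨fun _ => 0, E, HasMeroExt.of_analyticAt fun _ _ => analyticAt_const, hE, ?_⟩
    intro s _
    simp
  | succ N ihN =>
    obtain ⟨G, E', hG, hE', h⟩ := ihN
    refine ⟨fun s => ((c g : ℂ) * s + (b g + N + 1 : ℕ)) * G s
      + powIntegral (Function.update c g 0) (Function.update b g 0)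
        (fun p => E' (p.1, Function.update p.2 g 1)) s,
      fun p => (-1) * fderiv ℂ E' p (0, Pi.single g 1),
      (hG.analytic_mul fun s => by fun_prop).add (ih _ (hE'.comp_update g)), ?_, ?_⟩
    · exact AnalyticOnNhd.mul analyticOnNhd_const (hE'.fderiv_apply _)
    · intro s hs
      have h1 := mul_powIntegral c (Function.update b g (b g + N)) hE' hs hg
      simp only [Function.update_self, Function.update_idem] at h1
      have h2 : powIntegral c (Function.update b g (b g + N + 1))
          (fun p => (-1) * fderiv ℂ E' p (0, Pi.single g 1)) s
          = - powIntegral c (Function.update b g (b g + N + 1))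
          (fun p => fderiv ℂ E' p (0, Pi.single g 1)) s := by
        unfold powIntegral
        rw [← integral_neg]
        exact integral_congr_ae (Filter.Eventually.of_forall fun u => by simp only; ring)
      rw [Finset.prod_range_succ, ← add_assoc (b g) N 1, h2]
      push_cast at h1 h ⊢
      linear_combination ((c g : ℂ) * s + (b g + N + 1)) * h s hs + h1

/-- Induction on the number of bad variables, those whose exponent can have negative real part on Re
s > -M. Removing one of them costs one pole order. -/
theorem hasMeroExt_powIntegral (M d : ℕ) : ∀ (c b : Fin n → ℕ) (E : ℂ × (Fin n → ℂ) → ℂ),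
    AnalyticOnCube E → (Finset.univ.filter fun j => b j < c j * M).card ≤ d →
    HasMeroExt M d (powIntegral c b E) := by
  induction d with
  | zero =>
    intro c b E hE hd
    refine hasMeroExt_powIntegral_of_le c b hE fun j => not_lt.1 fun hj => ?_
    rw [Nat.le_zero, Finset.card_eq_zero, Finset.filter_eq_empty_iff] at hd
    exact hd (Finset.mem_univ j) hj
  | succ d ih =>
    intro c b E hE hd
    by_cases hbad : ∃ g, b g < c g * M
    · obtain ⟨g, hgb⟩ := hbad
      have hg : 1 ≤ c g := Nat.one_le_iff_ne_zero.2 fun h => by simp [h] at hgb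
      have hcard : ∀ c' b' : Fin n → ℕ, (∀ j ≠ g, c' j = c j ∧ b' j = b j) →
          c' g * M ≤ b' g → (Finset.univ.filter fun j => b' j < c' j * M).card ≤ d := by
        intro c' b' h1 h2
        have hsub : (Finset.univ.filter fun j => b' j < c' j * M)
            ⊆ (Finset.univ.filter fun j => b j < c j * M).erase g := by
          intro j hj
          have hj' := (Finset.mem_filter.1 hj).2
          have hjg : j ≠ g := fun h => by subst h; omega
          obtain ⟨k1, k2⟩ := h1 j hjg
          rw [k1, k2] at hj'
          exact Finset.mem_erase.2 ⟨hjg, Finset.mem_filter.2 ⟨Finset.mem_univ _, hj'⟩⟩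
        have := Finset.card_le_card hsub
        rw [Finset.card_erase_of_mem (Finset.mem_filter.2 ⟨Finset.mem_univ g, hgb⟩)] at this
        omega
      -- With `c g * M` steps the new exponent b_g + c_g M makes `g` good, while the boundary terms
      -- are good at `g` because their exponent there is 0.
      obtain ⟨G, E', hG, hE', h⟩ := prod_mul_powIntegral (M := M) (d := d) c b hE hg
        (fun E' hE' => ih _ _ _ hE' (hcard _ _ (fun j hj => by simp [hj]) (by simp))) (c g * M)
      refine (hG.add (ih c (Function.update b g (b g + c g * M)) E' hE'
        (hcard _ _ (fun j hj => by simp [hj]) (by simp)))).of_prod_mul hg (b g) (c g * M) h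
    · push Not at hbad
      exact (hasMeroExt_powIntegral_of_le c b hE hbad).mono (Nat.zero_le _)

end

/-! ### Jacobians, null hyperplanes and decompositions into charts -/

/-- The matrix is (1 + u vᵀ) diag(d), so the matrix determinant lemma applies. The Jacobians of
`blowup` and `radial` both have this shape. -/
theorem det_of_diagonal_add_rankOne {n : ℕ} (D : (Fin n → ℝ) →L[ℝ] (Fin n → ℝ))
    (d u v : Fin n → ℝ) (hD : ∀ h l, D h l = d l * h l + u l * ∑ m, v m * (d m * h m)) :
    D.det = (1 + ∑ m, v m * u m) * ∏ m, d m := by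
  have h1 : LinearMap.toMatrix' (D : (Fin n → ℝ) →ₗ[ℝ] (Fin n → ℝ))
      = (1 + Matrix.replicateCol Unit u * Matrix.replicateRow Unit v) * Matrix.diagonal d := by
    ext l m
    rw [LinearMap.toMatrix'_apply, Matrix.mul_diagonal]
    simp only [ContinuousLinearMap.coe_coe, hD, Matrix.add_apply,
      Matrix.mul_apply, Matrix.replicateCol_apply, Matrix.replicateRow_apply, Matrix.one_apply]
    simp [Pi.single_apply]
    split_ifs with h
    · subst h; ring
    · ring
  rw [ContinuousLinearMap.det, ← LinearMap.det_toMatrix', h1, Matrix.det_mul, Matrix.det_diagonal,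
    Matrix.det_one_add_replicateCol_mul_replicateRow]
  rfl

theorem ae_affineMap_ne_zero {n : ℕ} (a : (Fin n → ℝ) →ᵃ[ℝ] ℝ) {x₀ : Fin n → ℝ} (h : a x₀ ≠ 0) :
    ∀ᵐ x ∂(volume : Measure (Fin n → ℝ)), a x ≠ 0 := by
  let A : AffineSubspace ℝ (Fin n → ℝ) :=
    { carrier := {x | a x = 0}
      smul_vsub_vadd_mem' := fun c p₁ p₂ p₃ h1 h2 h3 => by
        have h1 : a p₁ = 0 := h1
        have h2 : a p₂ = 0 := h2
        have h3 : a p₃ = 0 := h3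
        have : a (c • (p₁ -ᵥ p₂) +ᵥ p₃) = 0 := by
          rw [AffineMap.map_vadd, map_smul, AffineMap.linearMap_vsub, h1, h2, h3]; simp
        exact this }
  have hA : A ≠ ⊤ := fun hA => h (by
    have : x₀ ∈ A := hA ▸ AffineSubspace.mem_top ℝ _ x₀
    exact this)
  exact compl_mem_ae_iff.2 (Measure.addHaar_affineSubspace volume A hA)

section Sectors

variable {n : ℕ}

/-- The part of the cube off the coordinate hyperplanes. -/
def posCube (n : ℕ) : Set (Fin n → ℝ) := {u | u ∈ cube n ∧ ∀ j, u j ≠ 0}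

theorem pos_of_mem_posCube {u : Fin n → ℝ} (hu : u ∈ posCube n) (j : Fin n) : 0 < u j :=
  lt_of_le_of_ne (mem_cube.1 hu.1 j).1 (hu.2 j).symm

theorem measurableSet_posCube : MeasurableSet (posCube n) := by
  have : posCube n = cube n ∩ ⋂ j, {u | u j ≠ 0} := by
    ext u; simp [posCube]
  rw [this]
  exact measurableSet_cube.inter (MeasurableSet.iInter fun j =>
    (measurableSet_singleton (0 : ℝ)).compl.preimage (measurable_pi_apply j))

theorem posCube_ae_eq : posCube n =ᵐ[volume] cube n := by
  have h := (ae_restrict_iff' (measurableSet_cube (n := n))).1 ae_cube_ne_zero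
  filter_upwards [h] with u hu
  exact propext ⟨fun h => h.1, fun h => ⟨h, hu h⟩⟩

/-- The charts may collapse coordinate hyperplanes, so the change of variables is made on `posCube`,
which differs from the cube by a null set. -/
theorem setIntegral_eq_sum_cube {ι : Type*} [Fintype ι] {K : Set (Fin n → ℝ)}
    {φ : ι → (Fin n → ℝ) → (Fin n → ℝ)} {D : ι → (Fin n → ℝ) → (Fin n → ℝ) →L[ℝ] (Fin n → ℝ)}
    (hD : ∀ i, ∀ y ∈ posCube n, HasFDerivAt (φ i) (D i y) y)
    (hinj : ∀ i, Set.InjOn (φ i) (posCube n)) (hmaps : ∀ i, Set.MapsTo (φ i) (posCube n) K)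
    (hcover : ∀ᵐ x, x ∈ K → ∃ i, x ∈ φ i '' posCube n)
    (hdisj : ∀ i i', i ≠ i' → ∀ᵐ x, ¬ (x ∈ φ i '' posCube n ∧ x ∈ φ i' '' posCube n))
    {H : (Fin n → ℝ) → ℂ} (hH : IntegrableOn H K) :
    ∫ x in K, H x = ∑ i, ∫ y in cube n, |(D i y).det| • H (φ i y) := by
  have hmeas : ∀ i, MeasurableSet (φ i '' posCube n) := fun i =>
    measurable_image_of_fderivWithin measurableSet_posCube
      (fun y hy => (hD i y hy).hasFDerivWithinAt) (hinj i)
  have hae : K =ᵐ[volume] ⋃ i, φ i '' posCube n := by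
    filter_upwards [hcover] with x hx
    refine propext ⟨fun h => Set.mem_iUnion.2 (hx h), fun h => ?_⟩
    obtain ⟨i, y, hy, rfl⟩ := Set.mem_iUnion.1 h
    exact hmaps i hy
  rw [setIntegral_congr_set hae, integral_iUnion_ae (fun i => (hmeas i).nullMeasurableSet) ?_
    (hH.congr_set_ae hae.symm), tsum_fintype]
  · refine Finset.sum_congr rfl fun i _ => ?_
    rw [integral_image_eq_integral_abs_det_fderiv_smul volume measurableSet_posCube
      (fun y hy => (hD i y hy).hasFDerivWithinAt) (hinj i), setIntegral_congr_set posCube_ae_eq]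
  · intro i i' hii
    have := hdisj i i' hii
    rw [ae_iff] at this
    simp only [not_not] at this
    exact this

/-- The chart of the blow-up of the coordinate subspace `{x | ∀ l ∈ T, x l = 0}` in which the
exceptional divisor is given by the `j`-th coordinate. -/
def blowup {R : Type*} [Mul R] (T : Finset (Fin n)) (j : Fin n) (y : Fin n → R) : Fin n → R :=
  fun l => if l ∈ T ∧ l ≠ j then y j * y l else y l

theorem blowup_self {R : Type*} [Mul R] (T : Finset (Fin n)) (j : Fin n) (y : Fin n → R) :
    blowup T j y j = y j := by simp [blowup]

theorem blowup_cx (T : Finset (Fin n)) (j : Fin n) (y : Fin n → ℝ) :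
    blowup T j (cx y) = cx (blowup T j y) := by
  funext l
  simp only [blowup, cx]
  split_ifs <;> simp

theorem blowup_mem_cube (T : Finset (Fin n)) (j : Fin n) {y : Fin n → ℝ} (hy : y ∈ cube n) :
    blowup T j y ∈ cube n := by
  rw [mem_cube] at *
  intro l
  unfold blowup
  split_ifs
  · exact ⟨mul_nonneg (hy j).1 (hy l).1, mul_le_one₀ (hy j).2 (hy l).1 (hy l).2⟩
  · exact hy l

theorem blowup_le (T : Finset (Fin n)) (j : Fin n) {y : Fin n → ℝ} (hy : y ∈ cube n)
    {l : Fin n} (hl : l ∈ T) : blowup T j y l ≤ blowup T j y j := by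
  rw [mem_cube] at hy
  rw [blowup_self]
  by_cases h : l = j
  · rw [h, blowup_self]
  · simp only [blowup, hl, ne_eq, h, not_false_eq_true, and_self, if_true]
    exact mul_le_of_le_one_right (hy j).1 (hy l).2

theorem injOn_blowup (T : Finset (Fin n)) (j : Fin n) :
    Set.InjOn (blowup T j : (Fin n → ℝ) → Fin n → ℝ) (posCube n) := by
  intro y hy z hz h
  have hj : y j = z j := by simpa [blowup_self] using congrFun h j
  funext l
  have hl := congrFun h l
  simp only [blowup] at hl
  split_ifs at hl
  · rw [hj] at hl
    exact mul_left_cancel₀ (hz.2 j) hl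
  · exact hl

/-- The derivative of `blowup`. -/
noncomputable def blowupDeriv (T : Finset (Fin n)) (j : Fin n) (y : Fin n → ℝ) :
    (Fin n → ℝ) →L[ℝ] (Fin n → ℝ) :=
  ContinuousLinearMap.pi fun l =>
    if l ∈ T ∧ l ≠ j then
      y j • ContinuousLinearMap.proj (R := ℝ) (φ := fun _ : Fin n => ℝ) l
        + y l • ContinuousLinearMap.proj (R := ℝ) (φ := fun _ : Fin n => ℝ) j
    else ContinuousLinearMap.proj (R := ℝ) (φ := fun _ : Fin n => ℝ) l

theorem hasFDerivAt_blowup (T : Finset (Fin n)) (j : Fin n) (y : Fin n → ℝ) :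
    HasFDerivAt (blowup T j) (blowupDeriv T j y) y := by
  refine hasFDerivAt_pi.2 fun l => ?_
  by_cases h : l ∈ T ∧ l ≠ j
  · simp only [blowup, h, if_true, ne_eq, not_false_eq_true, and_self]
    exact (hasFDerivAt_apply j y).mul (hasFDerivAt_apply l y)
  · simp only [blowup, h, if_false]
    exact hasFDerivAt_apply l y

theorem det_blowupDeriv {T : Finset (Fin n)} {j : Fin n} (hj : j ∈ T) (y : Fin n → ℝ) :
    (blowupDeriv T j y).det = y j ^ (T.card - 1) := by
  rw [det_of_diagonal_add_rankOne (blowupDeriv T j y)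
    (fun l => if l ∈ T ∧ l ≠ j then y j else 1) (fun l => if l ∈ T ∧ l ≠ j then y l else 0)
    (Pi.single j 1)]
  · have h1 : ∑ m, (Pi.single j 1 : Fin n → ℝ) m * (if m ∈ T ∧ m ≠ j then y m else 0) = 0 :=
      Finset.sum_eq_zero fun m _ => by
        by_cases h : m = j
        · subst h; simp
        · simp [h]
    rw [h1, add_zero, one_mul, Finset.prod_ite, Finset.prod_const_one, mul_one, Finset.prod_const]
    congr 1
    rw [← Finset.card_erase_of_mem hj]
    congr 1
    ext l; simp [and_comm]
  · intro h l
    have h2 : ∑ m, (Pi.single j 1 : Fin n → ℝ) m * ((if m ∈ T ∧ m ≠ j then y j else 1) * h m)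
        = h j := by
      rw [Finset.sum_eq_single j] <;> simp +contextual
    rw [h2]
    simp only [blowupDeriv, ContinuousLinearMap.pi_apply]
    split_ifs <;> simp

/-- The cube is cut according to which x_j with j in T is largest; ties lie in hyperplanes x_i =
x_i', which are null. -/
theorem setIntegral_cube_eq_sum_blowup {T : Finset (Fin n)} (hT : T.Nonempty)
    {H : (Fin n → ℝ) → ℂ} (hH : IntegrableOn H (cube n)) :
    ∫ x in cube n, H x
      = ∑ j : T, ∫ y in cube n, (y j : ℂ) ^ (T.card - 1) * H (blowup T j y) := by
  rw [setIntegral_eq_sum_cube (φ := fun j : T => blowup T j) (D := fun j : T => blowupDeriv T j)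
    (fun j y _ => hasFDerivAt_blowup T j y) (fun j => injOn_blowup T j)
    (fun j y hy => blowup_mem_cube T j hy.1) ?_ ?_ hH]
  · refine Finset.sum_congr rfl fun j _ => setIntegral_congr_fun measurableSet_cube fun y hy => ?_
    rw [det_blowupDeriv j.2, abs_of_nonneg (pow_nonneg (mem_cube.1 hy j).1 _),
      Complex.real_smul, Complex.ofReal_pow]
  · have h := posCube_ae_eq (n := n)
    filter_upwards [h] with x hx hxK
    have hxp : x ∈ posCube n := by
      have : posCube n x = cube n x := hx
      change posCube n x
      rw [this]; exact hxK
    -- The preimage in the chart of a maximal coordinate x_j is obtained by dividing the other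
    -- coordinates in `T` by x_j.
    obtain ⟨j, hj, hmax⟩ := T.exists_max_image x hT
    have hxj := pos_of_mem_posCube hxp j
    refine ⟨⟨j, hj⟩, fun l => if l ∈ T ∧ l ≠ j then x l / x j else x l, ⟨?_, ?_⟩, ?_⟩
    · rw [mem_cube] at *
      intro l
      split_ifs with h
      · exact ⟨div_nonneg (hxK l).1 hxj.le, (div_le_one hxj).2 (hmax l h.1)⟩
      · exact hxK l
    · intro l
      simp only
      split_ifs with h
      · exact div_ne_zero (hxp.2 l) hxj.ne'
      · exact hxp.2 l
    · funext l
      simp only [blowup]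
      split_ifs with h h2
      · exact absurd rfl h2.2
      · field_simp
      · rfl
  · intro i i' hii
    have hne : (i : Fin n) ≠ i' := fun h => hii (Subtype.ext h)
    have hae := ae_affineMap_ne_zero
      ((LinearMap.proj (R := ℝ) (φ := fun _ : Fin n => ℝ) (i : Fin n)
        - LinearMap.proj (R := ℝ) (φ := fun _ : Fin n => ℝ) (i' : Fin n)).toAffineMap)
      (x₀ := Pi.single (i : Fin n) 1) (by simp [hne.symm])
    filter_upwards [hae] with x hx
    rintro ⟨⟨y, hy, rfl⟩, ⟨z, hz, hzy⟩⟩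
    refine hx ?_
    have h1 := blowup_le T i hy.1 i'.2
    have h2 := blowup_le T i' hz.1 i.2
    rw [hzy] at h2
    simp only [LinearMap.coe_toAffineMap, LinearMap.sub_apply, LinearMap.proj_apply]
    linarith

end Sectors

/-! ### Powers of products of nonnegative linear forms -/

theorem analyticAt_apply {n : ℕ} (j : Fin n) (y : Fin n → ℂ) :
    AnalyticAt ℂ (fun y : Fin n → ℂ => y j) y :=
  (ContinuousLinearMap.proj (R := ℂ) (φ := fun _ : Fin n => ℂ) j).analyticAt y

namespace AnalyticOnCube

variable {n : ℕ}

theorem of_comp {S : Set (Fin n → ℝ)} {E : ℂ × (Fin n → ℂ) → ℂ}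
    (hE : AnalyticOnNhd ℂ E {p | ∃ x ∈ S, p.2 = cx x}) {Φ : (Fin n → ℂ) → Fin n → ℂ}
    {φ : (Fin n → ℝ) → Fin n → ℝ} (hΦ : ∀ x ∈ cube n, AnalyticAt ℂ Φ (cx x))
    (hφ : ∀ x ∈ cube n, φ x ∈ S) (h : ∀ x ∈ cube n, Φ (cx x) = cx (φ x)) :
    AnalyticOnCube (fun p => E (p.1, Φ p.2)) := by
  refine of_analyticAt fun s x hx => ?_
  refine AnalyticAt.fun_comp (f := fun p : ℂ × (Fin n → ℂ) => (p.1, Φ p.2)) ?_ ?_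
  · exact hE _ ⟨φ x, hφ x hx, h x hx⟩
  · exact analyticAt_fst.prod ((hΦ x hx).fun_comp (f := Prod.snd) analyticAt_snd)

theorem of_snd {U : (Fin n → ℂ) → ℂ} (hU : ∀ x ∈ cube n, AnalyticAt ℂ U (cx x)) :
    AnalyticOnCube (fun p => U p.2) :=
  of_analyticAt fun _ x hx => (hU x hx).fun_comp (f := Prod.snd) analyticAt_snd

/-- Positive real values lie in the slit plane, so the principal power is jointly analytic near the
cube. -/
theorem cpow {U : (Fin n → ℂ) → ℂ} {r : (Fin n → ℝ) → ℝ}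
    (hU : ∀ x ∈ cube n, AnalyticAt ℂ U (cx x)) (hr : ∀ x ∈ cube n, U (cx x) = r x)
    (hpos : ∀ x ∈ cube n, 0 < r x) : AnalyticOnCube (fun p => U p.2 ^ p.1) := by
  refine of_analyticAt fun s x hx => AnalyticAt.cpow
    ((hU x hx).fun_comp (f := Prod.snd) analyticAt_snd) analyticAt_fst ?_
  simp only
  rw [hr x hx]
  exact Complex.ofReal_mem_slitPlane.2 (hpos x hx)

end AnalyticOnCube

theorem ofReal_pow_cpow {x : ℝ} (hx : 0 ≤ x) (c : ℕ) (s : ℂ) :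
    ((x ^ c : ℝ) : ℂ) ^ s = (x : ℂ) ^ ((c : ℂ) * s) := by
  rw [Complex.cpow_nat_mul]
  induction c with
  | zero => simp
  | succ c ih =>
    rw [pow_succ, Complex.ofReal_mul, Complex.mul_cpow_ofReal_nonneg (pow_nonneg hx c) hx, ih,
      pow_succ]

theorem ofReal_prod_cpow {ι : Type*} (T : Finset ι) {x : ι → ℝ} (hx : ∀ i ∈ T, 0 ≤ x i) (s : ℂ) :
    ((∏ i ∈ T, x i : ℝ) : ℂ) ^ s = ∏ i ∈ T, (x i : ℂ) ^ s := by
  classical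
  induction T using Finset.induction_on with
  | empty => simp
  | insert i T hi ih =>
    rw [Finset.prod_insert hi, Finset.prod_insert hi, Complex.ofReal_mul,
      Complex.mul_cpow_ofReal_nonneg (hx i (by simp))
        (Finset.prod_nonneg fun j hj => hx j (by simp [hj])), ih fun j hj => hx j (by simp [hj])]

section

variable {n : ℕ} {ι : Type*}

/-- The product of a monomial and of linear forms. -/
def formProd (c : Fin n → ℕ) (R : Finset ι) (a : ι → Fin n → ℝ) (x : Fin n → ℝ) : ℝ :=
  (∏ j, x j ^ c j) * ∏ i ∈ R, ∑ j, a i j * x j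

theorem continuous_formProd (c : Fin n → ℕ) (R : Finset ι) (a : ι → Fin n → ℝ) :
    Continuous (formProd c R a) := by
  unfold formProd
  fun_prop

theorem formProd_nonneg (c : Fin n → ℕ) (R : Finset ι) {a : ι → Fin n → ℝ}
    (ha : ∀ i j, 0 ≤ a i j) {x : Fin n → ℝ} (hx : x ∈ cube n) : 0 ≤ formProd c R a x :=
  mul_nonneg (Finset.prod_nonneg fun j _ => pow_nonneg (mem_cube.1 hx j).1 _)
    (Finset.prod_nonneg fun i _ => Finset.sum_nonneg fun j _ =>
      mul_nonneg (ha i j) (mem_cube.1 hx j).1)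

theorem integrableOn_formProd (c : Fin n → ℕ) (R : Finset ι) (a : ι → Fin n → ℝ)
    {E : ℂ × (Fin n → ℂ) → ℂ} (hE : AnalyticOnCube E) {s : ℂ} (hs : 0 < s.re) :
    IntegrableOn (fun x => (formProd c R a x : ℂ) ^ s * E (s, cx x)) (cube n) :=
  ContinuousOn.integrableOn_compact isCompact_cube
    (((Complex.continuous_ofReal_cpow_const hs).comp
      (continuous_formProd c R a)).continuousOn.mul (hE.continuousOn s))

theorem hasMeroExt_formProd_empty (M : ℕ) (c : Fin n → ℕ) (a : ι → Fin n → ℝ)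
    {E : ℂ × (Fin n → ℂ) → ℂ} (hE : AnalyticOnCube E) :
    HasMeroExt M (Finset.univ.filter fun j => c j ≠ 0).card
      (fun s => ∫ x in cube n, (formProd c ∅ a x : ℂ) ^ s * E (s, cx x)) := by
  refine (hasMeroExt_powIntegral M _ c 0 E hE (Finset.card_le_card fun j hj => ?_)).congr
    fun s hs => setIntegral_congr_fun measurableSet_cube fun x hx => ?_
  · simp only [Finset.mem_filter, Finset.mem_univ, true_and] at hj ⊢
    intro h
    simp [h] at hj
  · rw [mem_cube] at hx
    simp only [formProd, Finset.prod_empty, mul_one, powMonomial, Pi.zero_apply, Nat.cast_zero,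
      add_zero]
    rw [ofReal_prod_cpow _ fun j _ => pow_nonneg (hx j).1 _]
    simp_rw [ofReal_pow_cpow (hx _).1]

theorem sum_mul_blowup {T : Finset (Fin n)} {j : Fin n} {a : Fin n → ℝ}
    (ha : ∀ l, a l ≠ 0 → l ∈ T) (y : Fin n → ℝ) :
    ∑ l, a l * blowup T j y l = y j * (a j + ∑ l ∈ Finset.univ.erase j, a l * y l) := by
  rw [← Finset.add_sum_erase _ _ (Finset.mem_univ j), blowup_self, mul_add, Finset.mul_sum]
  congr 1
  · ring
  · refine Finset.sum_congr rfl fun l hl => ?_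
    by_cases h : a l = 0
    · simp [h]
    · simp only [blowup, ha l h, Finset.ne_of_mem_erase hl, ne_eq, not_false_eq_true, and_self,
        if_true]
      ring

/-- The variables of the monomial lie outside T and are untouched. One y_j comes out of each form,
whence the exponent `R.card`. The forms with a_ij = 0 remain homogeneous; the others acquire the
constant term a_ij. -/
theorem formProd_blowup {T : Finset (Fin n)} {j : Fin n} (hj : j ∈ T) {c : Fin n → ℕ}
    (hc : ∀ l ∈ T, c l = 0) {R : Finset ι} {a : ι → Fin n → ℝ}
    (ha : ∀ i ∈ R, ∀ l, a i l ≠ 0 → l ∈ T) (y : Fin n → ℝ) :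
    formProd c R a (blowup T j y)
      = formProd (Function.update c j R.card) (R.filter fun i => a i j = 0) a y
        * ∏ i ∈ R.filter (fun i => ¬ a i j = 0),
          (a i j + ∑ l ∈ Finset.univ.erase j, a i l * y l) := by
  have h1 : ∏ l, blowup T j y l ^ c l = ∏ l, y l ^ c l := by
    refine Finset.prod_congr rfl fun l _ => ?_
    by_cases h : l ∈ T
    · simp [hc l h]
    · simp [blowup, h]
  have h2 : ∏ l, y l ^ (Function.update c j R.card l) = y j ^ R.card * ∏ l, y l ^ c l := by
    rw [← Finset.mul_prod_erase _ _ (Finset.mem_univ j),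
      ← Finset.mul_prod_erase _ (fun l => y l ^ c l) (Finset.mem_univ j), hc j hj]
    simp only [Function.update_self, pow_zero, one_mul]
    congr 1
    exact Finset.prod_congr rfl fun l hl => by
      rw [Function.update_of_ne (Finset.ne_of_mem_erase hl)]
  have h3 : ∏ i ∈ R.filter (fun i => a i j = 0), ∑ l, a i l * y l
      = ∏ i ∈ R.filter (fun i => a i j = 0),
        (a i j + ∑ l ∈ Finset.univ.erase j, a i l * y l) := by
    refine Finset.prod_congr rfl fun i hi => ?_
    have := (Finset.mem_filter.1 hi).2
    rw [← Finset.add_sum_erase _ _ (Finset.mem_univ j), this]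
    ring
  unfold formProd
  rw [h1, h2, h3, mul_assoc (_ * _), Finset.prod_filter_mul_prod_filter_not,
    Finset.prod_congr rfl fun i hi => sum_mul_blowup (ha i hi) y, Finset.prod_mul_distrib,
    Finset.prod_const]
  ring

/-- Induction on the number of forms by blowing up. The variables of the monomial stay disjoint from
those of the forms, because a form surviving in chart j does not contain y_j. -/
theorem hasMeroExt_formProd (M : ℕ) {a : ι → Fin n → ℝ} (ha : ∀ i j, 0 ≤ a i j) (r : ℕ) :
    ∀ (R : Finset ι), R.card ≤ r → (∀ i ∈ R, ∃ j, a i j ≠ 0) →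
    ∀ c : Fin n → ℕ, (∀ i ∈ R, ∀ j, a i j ≠ 0 → c j = 0) →
    ∀ E : ℂ × (Fin n → ℂ) → ℂ, AnalyticOnCube E →
    HasMeroExt M (min n ((Finset.univ.filter fun j => c j ≠ 0).card + r))
      (fun s => ∫ x in cube n, (formProd c R a x : ℂ) ^ s * E (s, cx x)) := by
  classical
  have hbase : ∀ (r : ℕ) (c : Fin n → ℕ) (E : ℂ × (Fin n → ℂ) → ℂ), AnalyticOnCube E →
      HasMeroExt M (min n ((Finset.univ.filter fun j => c j ≠ 0).card + r))
        (fun s => ∫ x in cube n, (formProd c (∅ : Finset ι) a x : ℂ) ^ s * E (s, cx x)) :=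
    fun r c E hE => (hasMeroExt_formProd_empty M c a hE).mono
      (le_min ((Finset.card_filter_le _ _).trans (by simp)) (Nat.le_add_right _ _))
  induction r with
  | zero =>
    intro R hR _ c _ E hE
    rw [Finset.card_eq_zero.1 (Nat.le_zero.1 hR)]
    exact hbase 0 c E hE
  | succ r ih =>
    intro R hR hne c hc E hE
    rcases R.eq_empty_or_nonempty with rfl | ⟨i₀, hi₀⟩
    · exact hbase _ c E hE
    -- The centre of the blow-up involves every variable of every remaining form, so that all forms
    -- become divisible by y_j at once.
    set T : Finset (Fin n) := Finset.univ.filter fun j => ∃ i ∈ R, a i j ≠ 0 with hT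
    have haT : ∀ i ∈ R, ∀ l, a i l ≠ 0 → l ∈ T := fun i hi l hl => by
      rw [hT, Finset.mem_filter]; exact ⟨Finset.mem_univ _, i, hi, hl⟩
    have hcT : ∀ l ∈ T, c l = 0 := fun l hl => by
      obtain ⟨i, hi, hil⟩ := (Finset.mem_filter.1 hl).2
      exact hc i hi l hil
    have hTne : T.Nonempty := by
      obtain ⟨j, hj⟩ := hne i₀ hi₀
      exact ⟨j, haT i₀ hi₀ j hj⟩
    -- The unit in chart j: each factor has a positive constant term, so the product is positive on
    -- the cube. `U` is its complexification.
    let V : Fin n → (Fin n → ℝ) → ℝ := fun j y => ∏ i ∈ R.filter (fun i => ¬ a i j = 0),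
          (a i j + ∑ l ∈ Finset.univ.erase j, a i l * y l)
    let U : Fin n → (Fin n → ℂ) → ℂ := fun j y => ∏ i ∈ R.filter (fun i => ¬ a i j = 0),
          ((a i j : ℂ) + ∑ l ∈ Finset.univ.erase j, (a i l : ℂ) * y l)
    have hV : ∀ j, ∀ x ∈ cube n, 0 < V j x := fun j x hx =>
      Finset.prod_pos fun i hi => add_pos_of_pos_of_nonneg
        (lt_of_le_of_ne (ha i j) (Ne.symm (Finset.mem_filter.1 hi).2))
        (Finset.sum_nonneg fun l _ => mul_nonneg (ha i l) (mem_cube.1 hx l).1)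
    have hUV : ∀ j x, U j (cx x) = V j x := fun j x => by
      simp [U, V, cx]
    have hU : ∀ j y, AnalyticAt ℂ (U j) y := fun j y =>
      Finset.analyticAt_fun_prod _ fun i _ => analyticAt_const.add
        (Finset.analyticAt_fun_sum _ fun l _ => analyticAt_const.mul (analyticAt_apply l y))
    have hB : ∀ j y, AnalyticAt ℂ (blowup T j : (Fin n → ℂ) → Fin n → ℂ) y := fun j y => by
      refine analyticAt_pi_iff.2 fun l => ?_
      by_cases h : l ∈ T ∧ l ≠ j
      · simp only [blowup, h, ne_eq, not_false_eq_true, and_self, if_true]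
        exact (analyticAt_apply j y).mul (analyticAt_apply l y)
      · simp only [blowup, h, if_false]
        exact analyticAt_apply l y
    -- The Jacobian power of y_j goes into the analytic factor, so the exponents of the monomial
    -- remain pure multiples of s.
    let E' : Fin n → ℂ × (Fin n → ℂ) → ℂ := fun j p =>
      U j p.2 ^ p.1 * (p.2 j ^ (T.card - 1) * E (p.1, blowup T j p.2))
    have hE' : ∀ j, AnalyticOnCube (E' j) := fun j =>
      (AnalyticOnCube.cpow (fun x _ => hU j _) (fun x _ => hUV j x) (hV j)).mul
        ((AnalyticOnCube.of_snd fun x _ => (analyticAt_apply j _).pow _).mul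
          (AnalyticOnCube.of_comp hE (fun x _ => hB j _) (fun x hx => blowup_mem_cube T j hx)
            fun x _ => blowup_cx T j x))
    have hsum : HasMeroExt M (min n ((Finset.univ.filter fun j => c j ≠ 0).card + (r + 1)))
        (fun s => ∑ j : T, ∫ y in cube n,
          (formProd (Function.update c j R.card) (R.filter fun i => a i j = 0) a y : ℂ) ^ s
            * E' j (s, cx y)) := by
      refine HasMeroExt.sum _ fun j _ => ?_
      obtain ⟨j, hj⟩ := j
      obtain ⟨i₁, hi₁, hij₁⟩ := (Finset.mem_filter.1 hj).2
      refine (ih (R.filter fun i => a i j = 0) ?_ (fun i hi => hne i (Finset.mem_filter.1 hi).1)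
        (Function.update c j R.card) ?_ (E' j) (hE' j)).mono ?_
      · have : (R.filter fun i => a i j = 0).card < R.card :=
          Finset.card_lt_card (Finset.filter_ssubset.2 ⟨i₁, hi₁, hij₁⟩)
        omega
      · intro i hi l hl
        obtain ⟨hiR, hij⟩ := Finset.mem_filter.1 hi
        rw [Function.update_of_ne (fun h : l = j => hl (by rw [h]; exact hij))]
        exact hc i hiR l hl
      -- At most one new variable, y_j, enters the monomial, and at least one form has left, so the
      -- sum does not grow.
      · refine min_le_min le_rfl ?_
        have hsub : (Finset.univ.filter fun l => Function.update c j R.card l ≠ 0)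
            ⊆ insert j (Finset.univ.filter fun l => c l ≠ 0) := by
          intro l hl
          by_cases h : l = j
          · simp [h]
          · simpa [h] using hl
        have := (Finset.card_le_card hsub).trans (Finset.card_insert_le _ _)
        omega
    refine hsum.congr fun s hs => ?_
    rw [setIntegral_cube_eq_sum_blowup hTne (integrableOn_formProd c R a hE hs)]
    refine Finset.sum_congr rfl fun j _ => setIntegral_congr_fun measurableSet_cube fun y hy => ?_
    simp only [E']
    rw [formProd_blowup j.2 hcT haT, Complex.ofReal_mul, Complex.mul_cpow_ofReal_nonneg
      (formProd_nonneg _ _ ha hy) (hV j y hy).le, hUV, ← blowup_cx]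
    simp only [cx]
    ring

end

/-! ### Signs of the affine forms -/

/-- For the principal branch a factor -1 contributes exp(πis), which is entire in s. -/
theorem exists_ofReal_sign_mul_cpow {ε : ℝ} (hε : ε = 1 ∨ ε = -1) :
    ∃ e : ℂ → ℂ, (∀ s, AnalyticAt ℂ e s) ∧
      ∀ W : ℝ, 0 ≤ W → ∀ s : ℂ, ((ε * W : ℝ) : ℂ) ^ s = e s * (W : ℂ) ^ s := by
  rcases hε with rfl | rfl
  · exact ⟨fun _ => 1, fun _ => analyticAt_const, fun W _ s => by simp⟩
  · refine ⟨fun s => Complex.exp (Real.pi * Complex.I * s), fun s => by fun_prop,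
      fun W hW s => ?_⟩
    rw [Complex.ofReal_cpow_of_nonpos (by linarith)]
    simp [mul_comm]

/-- Vertices are limits of interior points, so opposite signs at two vertices would occur in the
connected interior and force a zero there. If all vertex values vanished, f would vanish on the
whole hull. -/
theorem AffineMap.exists_sign_of_ne_zero_on_interior {ι V : Type*} [NormedAddCommGroup V]
    [NormedSpace ℝ V] [FiniteDimensional ℝ V] {p : ι → V}
    (hne : (interior (convexHull ℝ (Set.range p))).Nonempty) {f : V →ᵃ[ℝ] ℝ}
    (hf : ∀ x ∈ interior (convexHull ℝ (Set.range p)), f x ≠ 0) :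
    (∃ ε : ℝ, (ε = 1 ∨ ε = -1) ∧ ∀ j, f (p j) = ε * |f (p j)|) ∧ ∃ j, |f (p j)| ≠ 0 := by
  have hconv := convex_convexHull ℝ (Set.range p)
  have hcont : Continuous f := f.continuous_of_finiteDimensional
  have hcl : ∀ j, p j ∈ closure (interior (convexHull ℝ (Set.range p))) := fun j => by
    rw [hconv.closure_interior_eq_closure_of_nonempty_interior hne]
    exact subset_closure (subset_convexHull ℝ _ ⟨j, rfl⟩)
  constructor
  · by_cases h : ∃ j, f (p j) < 0
    · obtain ⟨j, hj⟩ := h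
      refine ⟨-1, Or.inr rfl, fun j' => ?_⟩
      suffices f (p j') ≤ 0 by rw [abs_of_nonpos this]; ring
      by_contra! hj'
      obtain ⟨x, hx, hxi⟩ := mem_closure_iff.1 (hcl j) {x | f x < 0}
        (isOpen_lt hcont continuous_const) hj
      obtain ⟨y, hy, hyi⟩ := mem_closure_iff.1 (hcl j') {x | 0 < f x}
        (isOpen_lt continuous_const hcont) hj'
      obtain ⟨z, hz, hz0⟩ := hconv.interior.isPreconnected.intermediate_value hxi hyi
        hcont.continuousOn ⟨le_of_lt hx, le_of_lt hy⟩
      exact hf z hz hz0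
    · push Not at h
      exact ⟨1, Or.inl rfl, fun j => by rw [abs_of_nonneg (h j), one_mul]⟩
  · by_contra! h
    obtain ⟨x, hx⟩ := hne
    refine hf x hx ?_
    have hsub : convexHull ℝ (Set.range p) ⊆ f ⁻¹' {0} :=
      convexHull_min (by rintro _ ⟨j, rfl⟩; exact abs_eq_zero.1 (h j))
        ((convex_singleton 0).affine_preimage f)
    exact hsub (interior_subset hx)

/-! ### Projective charts of the simplex -/

section Simplex

variable {n : ℕ}

/-- The affine basis given by the vertices of a full-dimensional simplex. -/
noncomputable def simplexBasis (V : Affine.Simplex ℝ (Fin n → ℝ) n) :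
    AffineBasis (Fin (n + 1)) ℝ (Fin n → ℝ) :=
  ⟨V.points, V.independent,
    (V.independent.affineSpan_eq_top_iff_card_eq_finrank_add_one).2 (by simp)⟩

theorem coe_simplexBasis (V : Affine.Simplex ℝ (Fin n → ℝ) n) : ⇑(simplexBasis V) = V.points := rfl

variable (b : AffineBasis (Fin (n + 1)) ℝ (Fin n → ℝ)) (i : Fin (n + 1))

/-- The linear map sending the `l`-th unit vector to the `l`-th edge at the vertex `b i`. -/
noncomputable def edgeMap : (Fin n → ℝ) →L[ℝ] (Fin n → ℝ) :=
  ∑ l, (ContinuousLinearMap.proj (R := ℝ) (φ := fun _ : Fin n => ℝ) l).smulRight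
    (b (i.succAbove l) - b i)

theorem edgeMap_apply (w : Fin n → ℝ) : edgeMap b i w = ∑ l, w l • (b (i.succAbove l) - b i) := by
  simp [edgeMap]

/-- The projective map `y ↦ (1 + ∑ y)⁻¹ y`. -/
noncomputable def radial (y : Fin n → ℝ) : Fin n → ℝ := (1 + ∑ l, y l)⁻¹ • y

/-- The projective chart of the simplex in which the `i`-th barycentric coordinate is maximal. -/
noncomputable def vertexChart (y : Fin n → ℝ) : Fin n → ℝ := edgeMap b i (radial y) + b i

/-- The complexification of `vertexChart`. -/
noncomputable def vertexChartC (y : Fin n → ℂ) : Fin n → ℂ := fun j =>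
  ∑ l, (1 + ∑ m, y m)⁻¹ * y l * ((b (i.succAbove l) - b i) j : ℝ) + (b i j : ℝ)

theorem one_add_sum_pos {y : Fin n → ℝ} (hy : y ∈ cube n) : 0 < 1 + ∑ l, y l :=
  add_pos_of_pos_of_nonneg one_pos (Finset.sum_nonneg fun l _ => (mem_cube.1 hy l).1)

theorem vertexChartC_cx (y : Fin n → ℝ) : vertexChartC b i (cx y) = cx (vertexChart b i y) := by
  funext j
  simp [vertexChartC, vertexChart, cx, edgeMap_apply, radial, Finset.mul_sum, mul_assoc]

theorem analyticAt_one_add_sum (y : Fin n → ℂ) :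
    AnalyticAt ℂ (fun y : Fin n → ℂ => 1 + ∑ m, y m) y :=
  analyticAt_const.add (Finset.analyticAt_fun_sum _ fun l _ => analyticAt_apply l y)

theorem one_add_sum_cx (y : Fin n → ℝ) : 1 + ∑ m, cx y m = ((1 + ∑ m, y m : ℝ) : ℂ) := by
  simp [cx]

theorem one_add_sum_cx_ne_zero {y : Fin n → ℝ} (hy : y ∈ cube n) : 1 + ∑ m, cx y m ≠ 0 := by
  rw [one_add_sum_cx]
  exact_mod_cast (one_add_sum_pos hy).ne'

theorem analyticAt_vertexChartC {y : Fin n → ℝ} (hy : y ∈ cube n) :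
    AnalyticAt ℂ (vertexChartC b i) (cx y) := by
  refine analyticAt_pi_iff.2 fun j => ?_
  refine AnalyticAt.add (Finset.analyticAt_fun_sum _ fun l _ => ?_) analyticAt_const
  exact (((analyticAt_one_add_sum _).fun_inv (one_add_sum_cx_ne_zero hy)).mul
    (analyticAt_apply l _)).mul analyticAt_const

/-- The chart has barycentric coordinates proportional to 1 at vertex i and y_l at the others, and f
is the corresponding average of its vertex values. -/
theorem AffineMap.vertexChart_apply (f : (Fin n → ℝ) →ᵃ[ℝ] ℝ) {y : Fin n → ℝ} (hy : y ∈ cube n) :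
    f (vertexChart b i y)
      = (1 + ∑ l, y l)⁻¹ * (f (b i) + ∑ l, f (b (i.succAbove l)) * y l) := by
  have hS := (one_add_sum_pos hy).ne'
  have h1 : f (vertexChart b i y) = f.linear (edgeMap b i (radial y)) + f (b i) := by
    rw [vertexChart, ← vadd_eq_add, AffineMap.map_vadd, vadd_eq_add]
  have h2 : ∀ l, f.linear (b (i.succAbove l) - b i) = f (b (i.succAbove l)) - f (b i) := fun l => by
    rw [← vsub_eq_sub, AffineMap.linearMap_vsub, vsub_eq_sub]
  rw [h1, edgeMap_apply, map_sum]
  simp only [map_smul, h2, radial, Pi.smul_apply, smul_eq_mul, mul_sub, Finset.sum_sub_distrib]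
  have h3 : ∑ l, (1 + ∑ m, y m)⁻¹ * y l * f (b (i.succAbove l))
      = (1 + ∑ m, y m)⁻¹ * ∑ l, f (b (i.succAbove l)) * y l := by
    rw [Finset.mul_sum]
    exact Finset.sum_congr rfl fun l _ => by ring
  rw [h3, ← Finset.sum_mul, ← Finset.mul_sum]
  field_simp
  ring

theorem coord_vertexChart_self {y : Fin n → ℝ} (hy : y ∈ cube n) :
    b.coord i (vertexChart b i y) = (1 + ∑ l, y l)⁻¹ := by
  rw [AffineMap.vertexChart_apply b i _ hy]
  simp [(Fin.succAbove_ne _ _).symm]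

theorem coord_vertexChart_succAbove {y : Fin n → ℝ} (hy : y ∈ cube n) (l : Fin n) :
    b.coord (i.succAbove l) (vertexChart b i y) = (1 + ∑ l, y l)⁻¹ * y l := by
  rw [AffineMap.vertexChart_apply b i _ hy]
  simp [AffineBasis.coord_apply]

theorem coord_vertexChart_le {y : Fin n → ℝ} (hy : y ∈ cube n) (i' : Fin (n + 1)) :
    b.coord i' (vertexChart b i y) ≤ b.coord i (vertexChart b i y) := by
  rcases eq_or_ne i' i with rfl | h
  · rfl
  · obtain ⟨l, rfl⟩ := Fin.exists_succAbove_eq h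
    rw [coord_vertexChart_self b i hy, coord_vertexChart_succAbove b i hy]
    exact mul_le_of_le_one_right (inv_nonneg.2 (one_add_sum_pos hy).le) (mem_cube.1 hy l).2

theorem vertexChart_mem {y : Fin n → ℝ} (hy : y ∈ cube n) :
    vertexChart b i y ∈ convexHull ℝ (Set.range b) := by
  rw [b.convexHull_eq_nonneg_coord]
  intro i'
  have h0 := inv_nonneg.2 (one_add_sum_pos hy).le
  rcases eq_or_ne i' i with rfl | h
  · rw [coord_vertexChart_self b _ hy]; exact h0
  · obtain ⟨l, rfl⟩ := Fin.exists_succAbove_eq h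
    rw [coord_vertexChart_succAbove b i hy]
    exact mul_nonneg h0 (mem_cube.1 hy l).1

theorem injOn_vertexChart : Set.InjOn (vertexChart b i) (posCube n) := by
  intro y hy z hz h
  have h1 := congrArg (b.coord i) h
  rw [coord_vertexChart_self b i hy.1, coord_vertexChart_self b i hz.1] at h1
  funext l
  have h2 := congrArg (b.coord (i.succAbove l)) h
  rw [coord_vertexChart_succAbove b i hy.1, coord_vertexChart_succAbove b i hz.1, h1] at h2
  exact mul_left_cancel₀ (inv_ne_zero (one_add_sum_pos hz.1).ne') h2

/-- The derivative of `radial`. -/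
noncomputable def radialDeriv (y : Fin n → ℝ) : (Fin n → ℝ) →L[ℝ] (Fin n → ℝ) :=
  (1 + ∑ l, y l)⁻¹ • ContinuousLinearMap.id ℝ (Fin n → ℝ)
    + ((-((1 + ∑ l, y l) ^ 2)⁻¹) •
        ∑ l, ContinuousLinearMap.proj (R := ℝ) (φ := fun _ : Fin n => ℝ) l).smulRight y

theorem hasFDerivAt_radial {y : Fin n → ℝ} (hy : y ∈ cube n) :
    HasFDerivAt radial (radialDeriv y) y := by
  have h1 : HasFDerivAt (fun y : Fin n → ℝ => 1 + ∑ l, y l)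
      (∑ l, ContinuousLinearMap.proj (R := ℝ) (φ := fun _ : Fin n => ℝ) l) y :=
    (HasFDerivAt.fun_sum fun l _ => hasFDerivAt_apply l y).const_add 1
  have h2 := (hasDerivAt_inv (one_add_sum_pos hy).ne').comp_hasFDerivAt y h1
  exact h2.smul (hasFDerivAt_id y)

theorem det_radialDeriv {y : Fin n → ℝ} (hy : y ∈ cube n) :
    (radialDeriv y).det = (1 + ∑ l, y l)⁻¹ ^ (n + 1) := by
  have hS := (one_add_sum_pos hy).ne'
  rw [det_of_diagonal_add_rankOne (radialDeriv y) (fun _ => (1 + ∑ l, y l)⁻¹)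
    (fun l => -(1 + ∑ l, y l)⁻¹ * y l) (fun _ => 1)]
  · simp only [one_mul, ← Finset.mul_sum, Finset.prod_const, Finset.card_univ, Fintype.card_fin]
    -- The rank-one factor 1 - Σy/(1 + Σy) equals (1 + Σy)⁻¹, which supplies the (n+1)-st power.
    rw [pow_succ']
    congr 1
    field_simp
    ring
  · intro h l
    simp only [radialDeriv, add_apply, smul_apply,
      ContinuousLinearMap.smulRight_apply, sum_apply, Pi.add_apply,
      Pi.smul_apply, smul_eq_mul, ContinuousLinearMap.proj_apply, one_mul, ← Finset.mul_sum,
      ContinuousLinearMap.id_apply]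
    field_simp

theorem hasFDerivAt_vertexChart {y : Fin n → ℝ} (hy : y ∈ cube n) :
    HasFDerivAt (vertexChart b i) ((edgeMap b i).comp (radialDeriv y)) y :=
  ((edgeMap b i).hasFDerivAt.comp y (hasFDerivAt_radial hy)).add_const _

theorem abs_det_vertexChart {y : Fin n → ℝ} (hy : y ∈ cube n) :
    |((edgeMap b i).comp (radialDeriv y)).det|
      = |(edgeMap b i).det| * (1 + ∑ l, y l)⁻¹ ^ (n + 1) := by
  have : ((edgeMap b i).comp (radialDeriv y)).det = (edgeMap b i).det * (radialDeriv y).det :=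
    LinearMap.det_comp _ _
  rw [this, abs_mul, det_radialDeriv hy,
    abs_of_nonneg (pow_nonneg (inv_nonneg.2 (one_add_sum_pos hy).le) _)]

/-- The chart at i is inverted by the ratios of the barycentric coordinates to the i-th one, which
lie in [0,1] when the i-th is maximal. Ties lie in null hyperplanes. -/
theorem setIntegral_convexHull_eq_sum {H : (Fin n → ℝ) → ℂ}
    (hH : IntegrableOn H (convexHull ℝ (Set.range b))) :
    ∫ x in convexHull ℝ (Set.range b), H x
      = ∑ i, ∫ y in cube n, ((|(edgeMap b i).det| * (1 + ∑ l, y l)⁻¹ ^ (n + 1) : ℝ) : ℂ)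
          * H (vertexChart b i y) := by
  rw [setIntegral_eq_sum_cube (φ := fun i => vertexChart b i)
    (D := fun i y => (edgeMap b i).comp (radialDeriv y))
    (fun i y hy => hasFDerivAt_vertexChart b i hy.1) (fun i => injOn_vertexChart b i)
    (fun i y hy => vertexChart_mem b i hy.1) ?_ ?_ hH]
  · refine Finset.sum_congr rfl fun i _ => setIntegral_congr_fun measurableSet_cube fun y hy => ?_
    rw [abs_det_vertexChart b i hy, Complex.real_smul]
  · have hae : ∀ᵐ x ∂(volume : Measure (Fin n → ℝ)), ∀ i, b.coord i x ≠ 0 :=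
      ae_all_iff.2 fun i => ae_affineMap_ne_zero (b.coord i) (x₀ := b i) (by simp)
    filter_upwards [hae] with x hx hxK
    rw [b.convexHull_eq_nonneg_coord] at hxK
    have hpos : ∀ i, 0 < b.coord i x := fun i => lt_of_le_of_ne (hxK i) (hx i).symm
    obtain ⟨i, -, hmax⟩ := Finset.univ.exists_max_image (fun i => b.coord i x)
      ⟨0, Finset.mem_univ _⟩
    let y : Fin n → ℝ := fun l => b.coord (i.succAbove l) x / b.coord i x
    have hy : y ∈ cube n := mem_cube.2 fun l =>
      ⟨div_nonneg (hxK _) (hxK _), (div_le_one (hpos i)).2 (hmax _ (Finset.mem_univ _))⟩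
    have hS : (1 + ∑ l, y l)⁻¹ = b.coord i x := by
      have hsum := b.sum_coord_apply_eq_one x
      rw [Fin.sum_univ_succAbove _ i] at hsum
      rw [inv_eq_iff_eq_inv]
      simp only [y, ← Finset.sum_div]
      have := (hpos i).ne'
      field_simp
      exact hsum
    refine ⟨i, y, ⟨hy, fun l => div_ne_zero (hx _) (hx _)⟩, b.ext_elem fun i' => ?_⟩
    rcases eq_or_ne i' i with rfl | h
    · rw [coord_vertexChart_self b _ hy, hS]
    · obtain ⟨l, rfl⟩ := Fin.exists_succAbove_eq h
      rw [coord_vertexChart_succAbove b i hy, hS]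
      exact mul_div_cancel₀ _ (hx i)
  · intro i i' hii
    filter_upwards [ae_affineMap_ne_zero (b.coord i - b.coord i') (x₀ := b i)
      (by simp [hii.symm])] with x hx
    rintro ⟨⟨y, hy, rfl⟩, ⟨z, hz, hzy⟩⟩
    refine hx ?_
    have h1 := coord_vertexChart_le b i hy.1 i'
    have h2 := coord_vertexChart_le b i' hz.1 i
    rw [hzy] at h2
    simp only [AffineMap.coe_sub, Pi.sub_apply]
    linarith

/-- Forms not vanishing at vertex i are positive on the cube, and their powers join E together with
the denominators. The at most k others are homogeneous, and no monomial is present yet, whence the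
bound min(n, k). -/
theorem hasMeroExt_simplex_chart (M : ℕ) {k : ℕ} {A : Fin k → Fin (n + 1) → ℝ}
    (hA : ∀ m j, 0 ≤ A m j) (hne : ∀ m, ∃ j, A m j ≠ 0) {E : ℂ × (Fin n → ℂ) → ℂ}
    (hE : AnalyticOnNhd ℂ E {p | ∃ x ∈ convexHull ℝ (Set.range b), p.2 = cx x}) :
    HasMeroExt M (min n k) (fun s => ∫ y in cube n,
      ((|(edgeMap b i).det| * (1 + ∑ l, y l)⁻¹ ^ (n + 1) : ℝ) : ℂ)
        * (((∏ m, (1 + ∑ l, y l)⁻¹ * (A m i + ∑ l, A m (i.succAbove l) * y l) : ℝ) : ℂ) ^ s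
          * E (s, cx (vertexChart b i y)))) := by
  classical
  set R : Finset (Fin k) := Finset.univ.filter fun m => A m i = 0 with hR
  let a : Fin k → Fin n → ℝ := fun m l => A m (i.succAbove l)
  let V : (Fin n → ℝ) → ℝ := fun y => (1 + ∑ l, y l)⁻¹ ^ k
    * ∏ m ∈ Finset.univ.filter (fun m => ¬ A m i = 0), (A m i + ∑ l, a m l * y l)
  let U : (Fin n → ℂ) → ℂ := fun y => (1 + ∑ l, y l)⁻¹ ^ k
    * ∏ m ∈ Finset.univ.filter (fun m => ¬ A m i = 0), ((A m i : ℂ) + ∑ l, (a m l : ℂ) * y l)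
  have hV : ∀ y ∈ cube n, 0 < V y := fun y hy =>
    mul_pos (pow_pos (inv_pos.2 (one_add_sum_pos hy)) _) (Finset.prod_pos fun m hm =>
      add_pos_of_pos_of_nonneg (lt_of_le_of_ne (hA m i) (Ne.symm (Finset.mem_filter.1 hm).2))
        (Finset.sum_nonneg fun l _ => mul_nonneg (hA m _) (mem_cube.1 hy l).1))
  have hUV : ∀ y, U (cx y) = V y := fun y => by simp [U, V, cx]
  have hU : ∀ y ∈ cube n, AnalyticAt ℂ U (cx y) := fun y hy =>
    (((analyticAt_one_add_sum _).fun_inv (one_add_sum_cx_ne_zero hy)).pow k).mul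
      (Finset.analyticAt_fun_prod _ fun m _ => analyticAt_const.add
        (Finset.analyticAt_fun_sum _ fun l _ => analyticAt_const.mul (analyticAt_apply l _)))
  let E' : ℂ × (Fin n → ℂ) → ℂ := fun p => U p.2 ^ p.1 *
    (((|(edgeMap b i).det| : ℝ) * (1 + ∑ l, p.2 l)⁻¹ ^ (n + 1)) * E (p.1, vertexChartC b i p.2))
  have hE' : AnalyticOnCube E' :=
    (AnalyticOnCube.cpow hU (fun y _ => hUV y) hV).mul
      ((AnalyticOnCube.of_snd fun y hy => analyticAt_const.mul
        (((analyticAt_one_add_sum _).fun_inv (one_add_sum_cx_ne_zero hy)).pow (n + 1))).mul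
      (AnalyticOnCube.of_comp hE (fun y hy => analyticAt_vertexChartC b i hy)
        (fun y hy => vertexChart_mem b i hy) fun y _ => vertexChartC_cx b i y))
  have hform := hasMeroExt_formProd M (a := a) (fun m l => hA m _) k R
    ((Finset.card_le_univ R).trans (by simp))
    (fun m hm => by
      obtain ⟨j, hj⟩ := hne m
      have hji : j ≠ i := fun h => hj (by rw [h]; exact (Finset.mem_filter.1 hm).2)
      obtain ⟨l, rfl⟩ := Fin.exists_succAbove_eq hji
      exact ⟨l, hj⟩)
    0 (fun _ _ _ _ => rfl) E' hE'
  simp only [Pi.zero_apply, ne_eq, not_true_eq_false, Finset.filter_false, Finset.card_empty,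
    zero_add] at hform
  refine hform.congr fun s _ => setIntegral_congr_fun measurableSet_cube fun y hy => ?_
  have hprod : ∏ m, (1 + ∑ l, y l)⁻¹ * (A m i + ∑ l, A m (i.succAbove l) * y l)
      = formProd 0 R a y * V y := by
    rw [Finset.prod_mul_distrib, Finset.prod_const, Finset.card_univ, Fintype.card_fin,
      ← Finset.prod_filter_mul_prod_filter_not Finset.univ (fun m => A m i = 0)]
    have : ∏ m ∈ R, (A m i + ∑ l, A m (i.succAbove l) * y l) = formProd 0 R a y := by
      simp only [formProd, Pi.zero_apply, pow_zero, Finset.prod_const_one, one_mul]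
      refine Finset.prod_congr rfl fun m hm => ?_
      rw [(Finset.mem_filter.1 hm).2, zero_add]
    rw [← hR, this]
    simp only [V, a]
    ring
  simp only [E']
  rw [hprod, Complex.ofReal_mul (formProd 0 R a y), Complex.mul_cpow_ofReal_nonneg
    (formProd_nonneg _ _ (fun m l => hA m _) hy) (hV y hy).le, hUV, vertexChartC_cx,
    one_add_sum_cx]
  push_cast
  ring

end Simplex

/-! ### Assembling the theorem -/

theorem lemma3p1 (n k : ℕ) (V : Affine.Simplex ℝ (Fin n → ℝ) n)
    (f : Fin k → ((Fin n → ℝ) →ᵃ[ℝ] ℝ))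
    (hf : ∀ i, ∀ x ∈ interior (convexHull ℝ (Set.range V.points)), f i x ≠ 0)
    (E : ℂ → (Fin n → ℂ) → ℂ)
    (hE : AnalyticOnNhd ℂ (fun p : ℂ × (Fin n → ℂ) => E p.1 p.2)
      {p | ∃ x ∈ convexHull ℝ (Set.range V.points), p.2 = fun j => (x j : ℂ)}) :
    ∃ F : ℂ → ℂ, Meromorphic F ∧
      (∀ s : ℂ, 0 < s.re →
        IntegrableOn (fun x : Fin n → ℝ => ((∏ i, f i x : ℝ) : ℂ) ^ s * E s (fun j => (x j : ℂ)))
          (convexHull ℝ (Set.range V.points)) volume ∧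
        F s = ∫ x in convexHull ℝ (Set.range V.points),
          ((∏ i, f i x : ℝ) : ℂ) ^ s * E s (fun j => (x j : ℂ)) ∧
        AnalyticAt ℂ F s) ∧
      (∀ s : ℂ, ¬ AnalyticAt ℂ F s → ∃ q : ℚ, s = (q : ℂ)) ∧
      (∀ s : ℂ, ((-(n : ℤ) : ℤ) : WithTop ℤ) ≤ meromorphicOrderAt F s) ∧
      (∀ s : ℂ, ((-(k : ℤ) : ℤ) : WithTop ℤ) ≤ meromorphicOrderAt F s) := by
  set b := simplexBasis V with hb
  set K := convexHull ℝ (Set.range V.points) with hK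
  have hKb : K = convexHull ℝ (Set.range b) := rfl
  have hint : (interior K).Nonempty := ⟨_, b.centroid_mem_interior_convexHull⟩
  have hsign := fun m => AffineMap.exists_sign_of_ne_zero_on_interior hint (hf m)
  choose ε hε hfε using fun m => (hsign m).1
  -- Only the sign of the whole product enters the power, so one entire factor `e` serves all
  -- charts.
  have hprodε : (∏ m, ε m) = 1 ∨ (∏ m, ε m) = -1 :=
    Finset.prod_induction ε (fun x => x = 1 ∨ x = -1)
      (by rintro x y (rfl | rfl) (rfl | rfl) <;> simp) (Or.inl rfl) fun m _ => hε m
  obtain ⟨e, he, heW⟩ := exists_ofReal_sign_mul_cpow hprodε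
  let A : Fin k → Fin (n + 1) → ℝ := fun m j => |f m (V.points j)|
  have hIntegrable : ∀ s : ℂ, 0 < s.re →
      IntegrableOn (fun x : Fin n → ℝ => ((∏ i, f i x : ℝ) : ℂ) ^ s * E s (cx x)) K := by
    intro s hs
    refine ContinuousOn.integrableOn_compact ((Set.finite_range V.points).isCompact_convexHull ℝ) ?_
    refine ContinuousOn.mul (Continuous.continuousOn
      ((Complex.continuous_ofReal_cpow_const hs).comp
        (continuous_finsetProd _ fun m _ => (f m).continuous_of_finiteDimensional))) ?_
    exact fun x hx => ((hE (s, cx x) ⟨x, hx, rfl⟩).continuousAt.comp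
      (f := fun x : Fin n → ℝ => (s, cx x))
      (by have := continuous_cx (n := n); fun_prop)).continuousWithinAt
  have hext : ∀ M, HasMeroExt M (min n k)
      (fun s => ∫ x in K, ((∏ i, f i x : ℝ) : ℂ) ^ s * E s (cx x)) := by
    intro M
    refine ((HasMeroExt.sum Finset.univ fun i _ => hasMeroExt_simplex_chart b i M
      (A := A) (fun _ _ => abs_nonneg _) (fun m => (hsign m).2) hE).analytic_mul he).congr
      fun s hs => ?_
    rw [hKb, setIntegral_convexHull_eq_sum b (hIntegrable s hs), Finset.mul_sum]
    refine Finset.sum_congr rfl fun i _ => ?_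
    rw [← integral_const_mul]
    refine setIntegral_congr_fun measurableSet_cube fun y hy => ?_
    have hfy : ∏ m, f m (vertexChart b i y) = (∏ m, ε m) *
        ∏ m, (1 + ∑ l, y l)⁻¹ * (A m i + ∑ l, A m (i.succAbove l) * y l) := by
      rw [← Finset.prod_mul_distrib]
      refine Finset.prod_congr rfl fun m _ => ?_
      rw [AffineMap.vertexChart_apply b i _ hy, hb, coe_simplexBasis, hfε m i]
      have : ∀ l, f m (V.points (i.succAbove l)) * y l
          = ε m * (A m (i.succAbove l) * y l) := fun l => by
        rw [hfε m (i.succAbove l)]; ring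
      simp only [this, ← Finset.mul_sum]
      ring
    have hnn : 0 ≤ ∏ m, (1 + ∑ l, y l)⁻¹ * (A m i + ∑ l, A m (i.succAbove l) * y l) :=
      Finset.prod_nonneg fun m _ => mul_nonneg (inv_nonneg.2 (one_add_sum_pos hy).le)
        (add_nonneg (abs_nonneg _) (Finset.sum_nonneg fun l _ =>
          mul_nonneg (abs_nonneg _) (mem_cube.1 hy l).1))
    simp only
    rw [hfy, heW _ hnn]
    ring
  obtain ⟨F, h1, h2, h3, h4⟩ := exists_meromorphic_of_hasMeroExt hext
  refine ⟨F, h1, fun s hs => ⟨hIntegrable s hs, (h2 s hs).1, (h2 s hs).2⟩, h3, fun s => ?_,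
    fun s => ?_⟩
  · refine le_trans ?_ (h4 s)
    exact_mod_cast (by omega : -(n : ℤ) ≤ -((min n k : ℕ) : ℤ))
  · refine le_trans ?_ (h4 s)
    exact_mod_cast (by omega : -(k : ℤ) ≤ -((min n k : ℕ) : ℤ))
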